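/- **Notation.** For $q\ge 2$ let $\mathbb T_q$ be the homogeneous tree of degree $q+1$ with a horocyclic structure: its edges are oriented so that every vertex $x$ has exactly one predecessor $x^-$ and $q$ successors (the vertices $y$ with $y^-=x$), and a vertex $o$ is chosen as origin. Any two vertices $x,y$ have a maximal common ancestor $x\wedge y$, and $\mathfrak h(x)=d(x,o\wedge x)-d(o,o\wedge x)$ is the Busemann function. For $d\ge 2$, the Diestel–Leader graph $DL_d(q)$ has as vertices the $x=x_1\cdots x_d\in(\mathbb T_q)^d$ with $\mathfrak h(x_1)+\dots+\mathfrak h(x_d)=0$; two vertices $x,y$ are neighbours if there are $i\ne j$ such that $x_i\sim y_i$, $x_j\sim y_j$ and $x_k=y_k$ for all $k\ne i,j$. (The horocyclic structure is arbitrary, and may be chosen separately for each of the $d$ trees.) A graph is the Cayley graph of a group $\Gamma$ with respect to a set $S\subset\Gamma$ if $S=S^{-1}$, $1\notin S$, $S$ generates $\Gamma$, and the graph is isomorphic to the graph with vertex set $\Gamma$ in which the neighbours of $g$ are the elements $gs$, $s\in S$. For a commutative ring $L$ and $\ell=(\ell_1,\dots,\ell_{d-1})\in L^{d-1}$, let $R_\ell=L[(t+\ell_1)^{-1},\dots,(t+\ell_{d-1})^{-1},t]$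 be the ring obtained from the polynomial ring $L[t]$ by inverting all $t+\ell_i$, let $\Gamma_\ell$ be the group of all matrices $$\begin{pmatrix}(t+\ell_1)^{k_1}\cdots(t+\ell_{d-1})^{k_{d-1}}&P\\0&1\end{pmatrix},\qquad k_1,\dots,k_{d-1}\in\mathbb Z,\ P\in R_\ell,$$ and let $S_\ell\subset\Gamma_\ell$ be the set of all matrices $$\begin{pmatrix}t+\ell_i&b\\0&1\end{pmatrix}^{\pm1}\quad\text{and}\quad\begin{pmatrix}(t+\ell_i)(t+\ell_j)^{-1}&-b(t+\ell_j)^{-1}\\0&1\end{pmatrix}\ (i\ne j),\qquad b\in L,\ i,j\in\{1,\dots,d-1\}.$$ **Theorem.** Let $d\ge 2$ and $q\ge 2$. 1. Let $L$ be a commutative ring of order $q$ and let $\ell_1,\dots,\ell_{d-1}\in L$ be such that $\ell_i-\ell_j$ is invertible for all $i\ne j$. Then $DL_d(q)$ is the Cayley graph of $\Gamma_\ell$ with respect to $S_\ell$. 2. Let $q=p_1\cdots p_r$ be the factorization of $q$ into powers of distinct primes, suppose that $p_\iota\ge d-1$ for all $\iota$, and let $L=\mathbb F_{p_1}\times\dots\times\mathbb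 F_{p_r}$, where $\mathbb F_{p_\iota}$ is the field of order $p_\iota$. Then $L$ has order $q$, and there are $\ell_1,\dots,\ell_{d-1}\in L$ such that for each $\iota$ the $\iota$-th coordinates of $\ell_1,\dots,\ell_{d-1}$ are distinct. For every such choice, $\ell_i-\ell_j$ is invertible for all $i\ne j$, and $DL_d(q)$ is the Cayley graph of $\Gamma_\ell$ with respect to $S_\ell$. 3. $DL_3(q)$ is the Cayley graph of the group of all matrices $\begin{pmatrix}t^k(t+1)^m&P\\0&1\end{pmatrix}$ with $k,m\in\mathbb Z$ and $P\in(\mathbb Z/q\mathbb Z)[t^{-1},(t+1)^{-1},t]$, with respect to the matrices $$\begin{pmatrix}t&b\\0&1\end{pmatrix},\quad\begin{pmatrix}t+1&b\\0&1\end{pmatrix},\quad\begin{pmatrix}t^{-1}+1&-b\,t^{-1}\\0&1\end{pmatrix},\qquad b\in\mathbb Z/q\mathbb Z,$$ and their inverses. -/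

import Mathlib

open scoped Polynomial

universe u v

noncomputable section

/-! ### Homogeneous trees with a horocyclic structure, and their horocyclic products -/

/-- The homogeneous tree of degree `q + 1` with a horocyclic structure: the edges are oriented so
that each vertex `x` has a unique predecessor `pred x` (its other `q` neighbours, the successors
of `x`, are the vertices `y` with `pred y = x`), and a vertex is chosen as the origin.
The orientation amounts to the choice of the end represented by the rays `x, pred x, …`. -/
structure HorocyclicTree (q : ℕ) where
  /-- the vertices -/
  V : Type u
  /-- the underlying graph -/
  graph : SimpleGraph V
  isTree : graph.IsTree
  degree_eq : ∀ x, (graph.neighborSet x).ncard = q + 1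
  /-- the predecessor `x⁻` of a vertex `x` -/
  pred : V → V
  adj_iff : ∀ x y, graph.Adj x y ↔ pred x = y ∨ pred y = x
  /-- no edge is oriented in both directions -/
  pred_pred_ne : ∀ x, pred (pred x) ≠ x
  /-- the reference vertex `o` -/
  origin : V

namespace HorocyclicTree

variable {q : ℕ} (T : HorocyclicTree.{u} q)

/-- `up x y = d(x, x ∧ y)`, where `x ∧ y` is the maximal common ancestor of `x` and `y`: the number
of steps from `x` up to the first of its ancestors that is also an ancestor of `y`. -/
def up (x y : T.V) : ℕ := sInf {m : ℕ | ∃ n : ℕ, T.pred^[m] x = T.pred^[n] y}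

/-- The Busemann function `𝔥(x) = d(x, o ∧ x) - d(o, o ∧ x)`. -/
def hor (x : T.V) : ℤ := (T.up x T.origin : ℤ) - T.up T.origin x

end HorocyclicTree

/-- The Diestel-Leader graph `DL_d(q)` for `ι = Fin d`: the horocyclic product of the trees `T i`,
`i ∈ ι`. Its vertices are the families `x` with `∑ i, 𝔥(x i) = 0`, and `x`, `y` are neighbours
when they are neighbours in exactly two of the trees and agree in all others. -/
def DiestelLeader {q : ℕ} {ι : Type} [Fintype ι] (T : ι → HorocyclicTree.{u} q) :
    SimpleGraph {x : (i : ι) → (T i).V // ∑ i, (T i).hor (x i) = 0} where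
  Adj x y := ∃ i j, i ≠ j ∧ (T i).graph.Adj (x.1 i) (y.1 i) ∧ (T j).graph.Adj (x.1 j) (y.1 j) ∧
    ∀ k, k ≠ i → k ≠ j → x.1 k = y.1 k
  symm := ⟨fun _ _ ⟨i, j, hij, hi, hj, h⟩ =>
    ⟨i, j, hij, hi.symm, hj.symm, fun k hki hkj => (h k hki hkj).symm⟩⟩
  loopless := ⟨fun _ ⟨_, _, _, hi, _⟩ => hi.ne rfl⟩

/-- `G` is the Cayley graph of the group `Γ` with respect to the symmetric set `S` of generators
(`g` and `g * s` being neighbours for `g ∈ Γ`, `s ∈ S`). -/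
def IsCayleyGraphOf {V : Type u} (G : SimpleGraph V) {Γ : Type v} [Group Γ] (S : Set Γ) : Prop :=
  (∀ s ∈ S, s⁻¹ ∈ S) ∧ 1 ∉ S ∧ Subgroup.closure S = ⊤ ∧ Nonempty (SimpleGraph.mulCayley S ≃g G)

/-! ### The ring of Laurent polynomials in `t + ℓ₁, …` and its group of affine matrices -/

section Affine

/-- The affine matrix with rows `a, P` and `0, 1`, for a unit `a`. -/
def affMat {R : Type u} [CommRing R] (a : Rˣ) (P : R) : GL (Fin 2) R where
  val := !![(a : R), P; 0, 1]
  inv := !![((a⁻¹ : Rˣ) : R), -((a⁻¹ : Rˣ) : R) * P; 0, 1]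
  val_inv := by simp [Matrix.one_fin_two]
  inv_val := by simp [Matrix.one_fin_two]

theorem affMat_mul {R : Type u} [CommRing R] (a b : Rˣ) (P Q : R) :
    affMat a P * affMat b Q = affMat (a * b) (a * Q + P) := by
  ext i j; fin_cases i <;> fin_cases j <;> simp [affMat]

theorem affMat_one {R : Type u} [CommRing R] : affMat (1 : Rˣ) (0 : R) = 1 := by
  ext i j; fin_cases i <;> fin_cases j <;> simp [affMat]

theorem affMat_inv {R : Type u} [CommRing R] (a : Rˣ) (P : R) :
    (affMat a P)⁻¹ = affMat a⁻¹ (-((a⁻¹ : Rˣ) : R) * P) := by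
  rw [inv_eq_iff_mul_eq_one, affMat_mul, ← affMat_one]
  congr 1 <;> simp

variable {L : Type u} [CommRing L] {ι : Type} (ℓ : ι → L)

/-- The ring `L[(t + ℓ_i)⁻¹ (i ∈ ι), t]`: the polynomial ring `L[t]` with all `t + ℓ_i` inverted. -/
abbrev LaurentRing : Type u :=
  Localization (Submonoid.closure (Set.range fun i => (Polynomial.X + Polynomial.C (ℓ i) : L[X])))

/-- The element `t + ℓ_i` as a unit of the ring `L[(t + ℓ_i)⁻¹ (i ∈ ι), t]`. -/
def tAdd (i : ι) : (LaurentRing ℓ)ˣ :=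
  (IsLocalization.map_units (LaurentRing ℓ)
    (⟨Polynomial.X + Polynomial.C (ℓ i), Submonoid.subset_closure ⟨i, rfl⟩⟩ :
      Submonoid.closure
        (Set.range fun i => (Polynomial.X + Polynomial.C (ℓ i) : L[X])))).unit

theorem tAdd_val (i : ι) : (tAdd ℓ i : LaurentRing ℓ) =
    algebraMap L[X] (LaurentRing ℓ) (Polynomial.X + Polynomial.C (ℓ i)) := rfl

/-- A constant `b ∈ L` as an element of `L[(t + ℓ_i)⁻¹ (i ∈ ι), t]`. -/
def constCoeff (b : L) : LaurentRing ℓ := algebraMap L[X] (LaurentRing ℓ) (Polynomial.C b)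

/-- The group of the affine matrices with rows `∏ i, (t + ℓ_i) ^ k_i, P` and `0, 1`, where
`k_i ∈ ℤ` and `P ∈ L[(t + ℓ_i)⁻¹ (i ∈ ι), t]`. -/
def affGroup [Fintype ι] : Subgroup (GL (Fin 2) (LaurentRing ℓ)) where
  carrier := {g | ∃ (k : ι → ℤ) (P : LaurentRing ℓ), g = affMat (∏ i, tAdd ℓ i ^ k i) P}
  mul_mem' := by
    rintro _ _ ⟨k, P, rfl⟩ ⟨m, Q, rfl⟩
    simp only [Set.mem_ofPred_eq, affMat_mul, ← Finset.prod_mul_distrib, ← zpow_add]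
    exact ⟨k + m, _, rfl⟩
  one_mem' := ⟨0, 0, by simp [affMat_one]⟩
  inv_mem' := by
    rintro _ ⟨k, P, rfl⟩
    simp only [Set.mem_ofPred_eq, affMat_inv, ← Finset.prod_inv_distrib, ← zpow_neg]
    exact ⟨-k, _, rfl⟩

/-- The matrices (rows `t + ℓ_i, b` and `0, 1`), their inverses, and the matrices
(rows `(t + ℓ_i)(t + ℓ_j)⁻¹, -b (t + ℓ_j)⁻¹` and `0, 1`) for `i ≠ j`, where `b ∈ L`. -/
def genMatrices : Set (GL (Fin 2) (LaurentRing ℓ)) :=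
  {g | ∃ (i : ι) (b : L), g = affMat (tAdd ℓ i) (constCoeff ℓ b) ∨
    g = (affMat (tAdd ℓ i) (constCoeff ℓ b))⁻¹} ∪
  {g | ∃ (i j : ι) (b : L), i ≠ j ∧ g = affMat (tAdd ℓ i * (tAdd ℓ j)⁻¹)
    (-(constCoeff ℓ b * (((tAdd ℓ j)⁻¹ : (LaurentRing ℓ)ˣ) : LaurentRing ℓ)))}

/-- All of `genMatrices ℓ` lies in the group `affGroup ℓ`. -/
theorem genMatrices_subset [Fintype ι] : genMatrices ℓ ⊆ affGroup ℓ := by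
  classical
  have h1 : ∀ i (P : LaurentRing ℓ), affMat (tAdd ℓ i) P ∈ affGroup ℓ := fun i P =>
    ⟨Pi.single i 1, P, by simp [Pi.single_apply, Finset.prod_ite_eq']⟩
  rintro g (⟨i, b, rfl | rfl⟩ | ⟨i, j, b, -, rfl⟩)
  · exact h1 i _
  · exact (affGroup ℓ).inv_mem (h1 i _)
  · have h2 := (affGroup ℓ).mul_mem (h1 i (-(constCoeff ℓ b *
      (((tAdd ℓ j)⁻¹ : (LaurentRing ℓ)ˣ) : LaurentRing ℓ)))) ((affGroup ℓ).inv_mem (h1 j 0))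
    rw [affMat_inv, affMat_mul] at h2
    simpa using h2

/-- The generators, as elements of the group `affGroup ℓ`. -/
def affGens [Fintype ι] : Set (affGroup ℓ) := {g | (g : GL (Fin 2) (LaurentRing ℓ)) ∈ genMatrices ℓ}

end Affine

/-! ### Three trees: the ring `(ℤ/qℤ)[t⁻¹, (t + 1)⁻¹, t]` -/

/-- The choice `ℓ₁ = 0`, `ℓ₂ = 1` in `ℤ/qℤ`. -/
abbrev zeroOne (q : ℕ) : Fin 2 → ZMod q := ![0, 1]

/-- The matrices (rows `t, b` and `0, 1`), (rows `t + 1, b` and `0, 1`),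
(rows `t⁻¹ + 1, -b t⁻¹` and `0, 1`), for `b ∈ ℤ/qℤ`. Here `tAdd (zeroOne q) 0 = t + 0`. -/
def genMatricesThree (q : ℕ) : Set (GL (Fin 2) (LaurentRing (zeroOne q))) :=
  {g | ∃ b : ZMod q,
    (g : Matrix (Fin 2) (Fin 2) (LaurentRing (zeroOne q))) =
      !![algebraMap (ZMod q)[X] _ Polynomial.X, constCoeff _ b; 0, 1] ∨
    (g : Matrix (Fin 2) (Fin 2) (LaurentRing (zeroOne q))) =
      !![algebraMap (ZMod q)[X] _ Polynomial.X + 1, constCoeff _ b; 0, 1] ∨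
    (g : Matrix (Fin 2) (Fin 2) (LaurentRing (zeroOne q))) =
      !![(((tAdd (zeroOne q) 0)⁻¹ : (LaurentRing (zeroOne q))ˣ) : LaurentRing (zeroOne q)) + 1,
        -(constCoeff _ b *
          (((tAdd (zeroOne q) 0)⁻¹ : (LaurentRing (zeroOne q))ˣ) : LaurentRing (zeroOne q)));
        0, 1]}

/-- The elements of `genMatricesThree q` and their inverses, as elements of the group of affine
matrices with rows `t ^ k * (t + 1) ^ m, P` and `0, 1`. -/
def affGensThree (q : ℕ) : Set (affGroup (zeroOne q)) :=
  {g | (g : GL (Fin 2) (LaurentRing (zeroOne q))) ∈ genMatricesThree q ∨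
    (g : GL (Fin 2) (LaurentRing (zeroOne q)))⁻¹ ∈ genMatricesThree q}

/-! ### The ring `𝔽_{p₁} × ⋯ × 𝔽_{p_r}` for the factorization `q = p₁ ⋯ p_r` in prime powers -/

instance factPrimeOfMemPrimeFactors (q : ℕ) (p : q.primeFactors) : Fact (p : ℕ).Prime :=
  ⟨Nat.prime_of_mem_primeFactors p.2⟩

/-- The product, over the primes `p` dividing `q`, of the fields of order `p ^ v`, where `p ^ v` is
the largest power of `p` that divides `q`. -/
abbrev FieldProduct (q : ℕ) : Type :=
  (p : q.primeFactors) → GaloisField (p : ℕ) (q.factorization (p : ℕ))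

end

/-! The `d` trees correspond to `d` places of the projective line over `L`: the points `t = -ℓ_i`
and infinity. After labelling successors by elements of `L`, a vertex of height `n` is a ball of
level `n` in the Laurent series over `L`. The labelling is almost arbitrary, so every horocyclic
structure is covered. Elements of `LaurentRing ℓ` are dense at each place
(`exists_sub_expandShift_mem`), so the vertices of height `n` at a place are also the classes of
ring elements modulo those vanishing to order `n` there.

An element `(k, P)` of the group is sent to the tuple of balls around `P` whose levels are the
valuations of `∏ (t + ℓ_i) ^ k_i`. These valuations sum to zero, which is the condition on heights.
Bijectivity is partial fractions: principal parts at the places can be prescribed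
(`exists_forall_sub_mem_vanishing`), and only zero has none (`eq_zero_of_forall_mem_vanishing`).
Shifting the order by one at infinity excludes the constants, so that both halves hold together.

An edge raises the level by one at a place `o` and lowers it by one at a place `o'`. The differences
`Q - P` this permits are the `L`-multiples of a single element (`forall_mem_vanishing_iff`), and
these are exactly the entries of the generators. Since `L` may have zero divisors, valuations are
used only for series with invertible leading coefficient (`HasUnitLead`). Invertibility of `ℓ_i -
ℓ_j` puts the `t + ℓ_i` among them. -/

namespace HorocyclicTree

/-! ### Ancestors and heights in a horocyclic tree -/

section Height

variable {q : ℕ} (T : HorocyclicTree.{u} q)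

theorem adj_pred (x : T.V) : T.graph.Adj x (T.pred x) := (T.adj_iff _ _).2 (Or.inl rfl)

/-- A shortest closed chain of predecessors would lead from `pred x` back to `x` without the edge
between them, but every edge of a tree is a bridge. -/
theorem iterate_pred_ne_self (x : T.V) {n : ℕ} (hn : 0 < n) : T.pred^[n] x ≠ x := by
  classical
  intro hx
  have hex : ∃ n, 0 < n ∧ T.pred^[n] x = x := ⟨n, hn, hx⟩
  obtain ⟨hN, hNx⟩ := Nat.find_spec hex
  set N := Nat.find hex
  have hmin : ∀ m, 0 < m → m < N → T.pred^[m] x ≠ x := fun m h0 hm h =>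
    Nat.find_min hex hm ⟨h0, h⟩
  have hbr := SimpleGraph.isAcyclic_iff_forall_adj_isBridge.1 T.isTree.isAcyclic (T.adj_pred x)
  rw [SimpleGraph.isBridge_iff] at hbr
  apply hbr
  have key : ∀ m, 0 < m → m ≤ N →
      (T.graph.deleteEdges {s(x, T.pred x)}).Reachable (T.pred x) (T.pred^[m] x) := by
    intro m h0 hm
    induction m with
    | zero => omega
    | succ m ih =>
      rcases Nat.eq_zero_or_pos m with rfl | hpos
      · exact SimpleGraph.Reachable.refl _
      · refine (ih hpos (by omega)).trans (SimpleGraph.Adj.reachable ?_)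
        rw [SimpleGraph.deleteEdges_adj, Function.iterate_succ_apply']
        refine ⟨T.adj_pred _, fun h => ?_⟩
        rw [Set.mem_singleton_iff, Sym2.eq_iff] at h
        rcases h with ⟨h, -⟩ | ⟨h, h'⟩
        · exact hmin m hpos (by omega) h
        · rw [h] at h'
          exact T.pred_pred_ne x h'
  have := key N hN le_rfl
  rw [hNx] at this
  exact this.symm

theorem iterate_pred_injective (x : T.V) : Function.Injective fun n => T.pred^[n] x := by
  have key : ∀ a b, a ≤ b → T.pred^[a] x = T.pred^[b] x → a = b := by
    intro a b hab h
    by_contra hne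
    obtain ⟨c, rfl⟩ := Nat.exists_eq_add_of_lt (lt_of_le_of_ne hab hne)
    refine T.iterate_pred_ne_self (T.pred^[a] x) (Nat.succ_pos c) ?_
    rw [← Function.iterate_add_apply, h]
    congr 1
    omega
  intro a b h
  rcases le_total a b with hab | hab
  · exact key a b hab h
  · exact (key b a hab h.symm).symm

theorem exists_common_ancestor (x y : T.V) : ∃ m n : ℕ, T.pred^[m] x = T.pred^[n] y := by
  obtain ⟨p⟩ := T.isTree.connected.preconnected x y
  induction p with
  | nil => exact ⟨0, 0, rfl⟩
  | @cons a b c h p ih =>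
    obtain ⟨m, n, hmn⟩ := ih
    rcases (T.adj_iff a b).1 h with h | h
    · exact ⟨m + 1, n, by rw [Function.iterate_succ_apply, h, hmn]⟩
    · refine ⟨m, n + 1, ?_⟩
      rw [Function.iterate_succ_apply', ← hmn, ← h, ← Function.iterate_succ_apply,
        Function.iterate_succ_apply']

theorem sub_eq_sub_of_common_ancestor {x y : T.V} {m n m' n' : ℕ}
    (h : T.pred^[m] x = T.pred^[n] y) (h' : T.pred^[m'] x = T.pred^[n'] y) :
    (m : ℤ) - n = m' - n' := by
  have : m' + n = m + n' := by
    apply T.iterate_pred_injective y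
    simp only [Function.iterate_add_apply]
    rw [← h, ← h', ← Function.iterate_add_apply, ← Function.iterate_add_apply, add_comm]
  omega

/-- The difference of the two step counts is the same for every common ancestor, so the height can
be read off without a maximal one. -/
theorem hor_eq_sub {x : T.V} {m n : ℕ} (h : T.pred^[m] x = T.pred^[n] T.origin) :
    T.hor x = m - n := by
  have h1 : ∃ b, T.pred^[T.up x T.origin] x = T.pred^[b] T.origin :=
    Nat.sInf_mem (s := {m : ℕ | ∃ n : ℕ, T.pred^[m] x = T.pred^[n] T.origin}) ⟨m, n, h⟩
  have h2 : ∃ b, T.pred^[T.up T.origin x] T.origin = T.pred^[b] x :=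
    Nat.sInf_mem (s := {m : ℕ | ∃ n : ℕ, T.pred^[m] T.origin = T.pred^[n] x}) ⟨n, m, h.symm⟩
  obtain ⟨b, hb⟩ := h1
  obtain ⟨c, hc⟩ := h2
  have h3 : T.up x T.origin ≤ c :=
    Nat.sInf_le (s := {m : ℕ | ∃ n : ℕ, T.pred^[m] x = T.pred^[n] T.origin}) ⟨_, hc.symm⟩
  have h4 : T.up T.origin x ≤ b :=
    Nat.sInf_le (s := {m : ℕ | ∃ n : ℕ, T.pred^[m] T.origin = T.pred^[n] x}) ⟨_, hb.symm⟩
  have h5 := T.sub_eq_sub_of_common_ancestor hb hc.symm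
  have h6 := T.sub_eq_sub_of_common_ancestor h hb
  unfold hor
  omega

theorem hor_iterate_pred (x : T.V) (n : ℕ) : T.hor (T.pred^[n] x) = T.hor x - n := by
  obtain ⟨a, b, h⟩ := T.exists_common_ancestor x T.origin
  rw [T.hor_eq_sub h, T.hor_eq_sub (x := T.pred^[n] x) (m := a) (n := n + b)]
  · push_cast; ring
  · rw [← Function.iterate_add_apply, add_comm, Function.iterate_add_apply, h,
      ← Function.iterate_add_apply]

theorem hor_pred (x : T.V) : T.hor (T.pred x) = T.hor x - 1 := by
  simpa using T.hor_iterate_pred x 1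

theorem hor_origin : T.hor T.origin = 0 := by
  simpa using T.hor_eq_sub (x := T.origin) (m := 0) (n := 0) rfl

theorem exists_iterate_pred_eq {x y : T.V} (h : T.hor x = T.hor y) :
    ∃ n : ℕ, T.pred^[n] x = T.pred^[n] y := by
  obtain ⟨m, n, hmn⟩ := T.exists_common_ancestor x y
  have := congrArg T.hor hmn
  rw [hor_iterate_pred, hor_iterate_pred] at this
  obtain rfl : m = n := by omega
  exact ⟨m, hmn⟩

theorem card_successors (x : T.V) : {y | T.pred y = x}.ncard = q := by
  have h : T.graph.neighborSet x = insert (T.pred x) {y | T.pred y = x} := by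
    ext y
    rw [SimpleGraph.mem_neighborSet, T.adj_iff, Set.mem_insert_iff, eq_comm (a := y)]
    rfl
  have hfin : (T.graph.neighborSet x).Finite :=
    Set.finite_of_ncard_ne_zero (by rw [T.degree_eq]; omega)
  have hd := T.degree_eq x
  rw [h] at hfin
  have hx : T.pred x ∉ {y | T.pred y = x} := T.pred_pred_ne x
  rw [h, Set.ncard_insert_of_notMem hx (hfin.subset (Set.subset_insert _ _))] at hd
  omega

end Height

/-! ### Vertices as balls of Laurent series -/

section Coordinates

variable {q : ℕ} (T : HorocyclicTree.{u} q) {L : Type v}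

/-- The successors of every vertex can be labelled bijectively by the elements of a set with `q`
elements so that all ancestors of the origin have the same label. -/
theorem exists_labelling [Zero L] [Finite L] (hL : Nat.card L = q) :
    ∃ lab : T.V → L, (∀ x c, ∃ y, T.pred y = x ∧ lab y = c) ∧
      (∀ y z, T.pred y = T.pred z → lab y = lab z → y = z) ∧
      ∀ n : ℕ, lab (T.pred^[n] T.origin) = 0 := by
  classical
  have hq : 0 < q := hL ▸ Nat.card_pos
  have key : ∀ x, ∃ e : {y | T.pred y = x} ≃ L,
      ∀ y : {y | T.pred y = x}, (∃ n : ℕ, T.pred^[n] T.origin = y) → e y = 0 := by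
    intro x
    have hfin : Finite {y | T.pred y = x} :=
      (Set.finite_of_ncard_ne_zero (by rw [T.card_successors]; omega)).to_subtype
    have hc : Nat.card {y | T.pred y = x} = Nat.card L := by
      rw [hL]
      exact T.card_successors x
    obtain ⟨e⟩ : Nonempty ({y | T.pred y = x} ≃ L)  :=
      ⟨(Nat.equivFinOfCardPos (by rw [hc]; omega)).trans ((finCongr hc).trans (Finite.equivFin L).symm)⟩
    by_cases h : ∃ y : {y | T.pred y = x}, ∃ n : ℕ, T.pred^[n] T.origin = y
    · obtain ⟨y, n, hy⟩ := h
      -- At most one successor of `x` is an ancestor of the origin, so a single transposition gives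
      -- it the label `0`.
      refine ⟨e.trans (Equiv.swap (e y) 0), ?_⟩
      rintro z ⟨m, hz⟩
      have : T.pred^[n + 1] T.origin = T.pred^[m + 1] T.origin := by
        rw [Function.iterate_succ_apply', Function.iterate_succ_apply', hy, hz, y.2, z.2]
      have := T.iterate_pred_injective _ this
      obtain rfl : n = m := by omega
      have : z = y := Subtype.ext (hz.symm.trans hy)
      simp [this]
    · exact ⟨e, fun y hy => (h ⟨y, hy⟩).elim⟩
  choose e he using key
  refine ⟨fun y => e (T.pred y) ⟨y, rfl⟩, ?_, ?_, ?_⟩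
  · intro x c
    obtain ⟨⟨y, rfl⟩, hy⟩ := (e x).surjective c
    exact ⟨y, rfl, hy⟩
  · intro y z hyz h
    have h2 : e (T.pred y) ⟨z, hyz.symm⟩ = e (T.pred z) ⟨z, rfl⟩ := by
      have : ∀ (a b : T.V) (h : a = b) (w : {y | T.pred y = a}),
          e a w = e b ⟨w, w.2.trans h⟩ := by
        rintro a _ rfl w
        rfl
      exact this _ _ hyz _
    have h3 := (e (T.pred y)).injective (h.trans h2.symm)
    exact congrArg Subtype.val h3
  · intro n
    exact he _ _ ⟨n, rfl⟩

/-- A homogeneous tree with a horocyclic structure is the tree of balls in the Laurent series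
over a ring with `q` elements: `Θ n f` is the ball of level `n` around `f`. -/
theorem exists_laurentSeries_coordinates [Zero L] [Finite L] (hL : Nat.card L = q) :
    ∃ Θ : ℤ → HahnSeries ℤ L → T.V,
      (∀ n f, T.hor (Θ n f) = n) ∧ (∀ n f, T.pred (Θ n f) = Θ (n - 1) f) ∧
      (∀ n f g, Θ n f = Θ n g ↔ ∀ m < n, f.coeff m = g.coeff m) ∧
      ∀ x, ∃ f, Θ (T.hor x) f = x := by
  obtain ⟨lab, hsurj, hinj, hzero⟩ := T.exists_labelling hL
  -- The coefficient at `m` is the label of the ancestor of height `m + 1`. Far up, the coefficients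
  -- vanish and the ancestors of the origin have label `0`; from there one descends, one coefficient
  -- at a time.
  have hex : ∀ (n : ℤ) (f : HahnSeries ℤ L), ∃ x, T.hor x = n ∧
      ∀ i : ℕ, lab (T.pred^[i] x) = f.coeff (n - 1 - i) := by
    intro n f
    obtain ⟨N, hN, hNf⟩ : ∃ N : ℕ, (-N : ℤ) ≤ n ∧ ∀ m < (-N : ℤ), f.coeff m = 0 :=
      ⟨(-n).toNat + (-f.order).toNat, by omega, fun m hm =>
        HahnSeries.coeff_eq_zero_of_lt_order (by omega)⟩
    have key : ∀ k : ℕ, ∃ x, T.hor x = -N + k ∧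
        ∀ i : ℕ, lab (T.pred^[i] x) = f.coeff (-N + k - 1 - i) := by
      intro k
      induction k with
      | zero =>
        refine ⟨T.pred^[N] T.origin, by rw [hor_iterate_pred, hor_origin]; simp, fun i => ?_⟩
        rw [← Function.iterate_add_apply, hzero, hNf]
        push_cast
        omega
      | succ k ih =>
        obtain ⟨x, hx, hlab⟩ := ih
        obtain ⟨y, rfl, hy⟩ := hsurj x (f.coeff (-N + k))
        refine ⟨y, ?_, fun i => ?_⟩
        · rw [hor_pred] at hx
          push_cast
          omega
        · cases i with
          | zero =>
            rw [Function.iterate_zero, id, hy]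
            congr 1
            push_cast
            ring
          | succ i =>
            rw [Function.iterate_succ_apply, hlab]
            congr 1
            push_cast
            ring
    obtain ⟨x, hx, hlab⟩ := key (n + N).toNat
    rw [show (-N + ((n + N).toNat : ℤ)) = n by omega] at hx hlab
    exact ⟨x, hx, hlab⟩
  have huniq : ∀ (m : ℕ) (x y : T.V), T.pred^[m] x = T.pred^[m] y →
      (∀ i : ℕ, lab (T.pred^[i] x) = lab (T.pred^[i] y)) → x = y := by
    intro m
    induction m with
    | zero => intro x y h _; exact h
    | succ m ih =>
      intro x y h hl
      refine hinj x y (ih _ _ h fun i => ?_) (hl 0)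
      exact hl (i + 1)
  choose Θ hΘ hlab using hex
  refine ⟨Θ, hΘ, ?_, ?_, ?_⟩
  · intro n f
    have hh : T.hor (T.pred (Θ n f)) = T.hor (Θ (n - 1) f) := by rw [hor_pred, hΘ, hΘ]
    obtain ⟨m, hm⟩ := T.exists_iterate_pred_eq hh
    refine huniq m _ _ hm fun i => ?_
    rw [← Function.iterate_succ_apply, hlab, hlab]
    congr 1
    push_cast
    ring
  · intro n f g
    constructor
    · intro h m hm
      obtain ⟨i, hi⟩ := Int.eq_ofNat_of_zero_le (show 0 ≤ n - 1 - m by omega)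
      have h1 := hlab n f i
      rw [h, hlab] at h1
      rw [show m = n - 1 - i by omega]
      exact h1.symm
    · intro h
      obtain ⟨m, hm⟩ := T.exists_iterate_pred_eq ((hΘ n f).trans (hΘ n g).symm)
      refine huniq m _ _ hm fun i => ?_
      rw [hlab, hlab]
      exact h _ (by omega)
  · intro x
    obtain ⟨a, b, hab⟩ := T.exists_common_ancestor x T.origin
    -- From the `a`-th step on, the ancestors of `x` are ancestors of the origin and carry the label
    -- `0`, so the labels form a Laurent series.
    have hb : BddBelow (Function.support fun m : ℤ =>
        if m < T.hor x then lab (T.pred^[(T.hor x - 1 - m).toNat] x) else 0) := by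
      refine ⟨T.hor x - 1 - a, fun m hm => ?_⟩
      by_contra hlt
      apply hm
      dsimp only
      rw [if_pos (by omega),
        show (T.hor x - 1 - m).toNat = (T.hor x - 1 - m).toNat - a + a by omega,
        Function.iterate_add_apply, hab, ← Function.iterate_add_apply, hzero]
    refine ⟨HahnSeries.ofSuppBddBelow _ hb, ?_⟩
    obtain ⟨m, hm⟩ := T.exists_iterate_pred_eq (hΘ (T.hor x) (HahnSeries.ofSuppBddBelow _ hb))
    refine huniq m _ _ hm fun i => ?_
    rw [hlab, HahnSeries.coeff_ofSuppBddBelow]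
    rw [if_pos (by omega)]
    congr 2
    omega

end Coordinates

end HorocyclicTree

noncomputable section

open HahnSeries

/-! ### Laurent series without terms of degree less than `n` -/

section LaurentSeries

variable {L : Type v} [CommRing L]

/-- The Laurent series without terms of degree less than `n`. -/
def coeffsFrom (L : Type v) [CommRing L] (n : ℤ) : AddSubgroup (HahnSeries ℤ L) where
  carrier := {f | ∀ m < n, f.coeff m = 0}
  zero_mem' := fun _ _ => rfl
  add_mem' := fun hf hg m hm => by simp [hf m hm, hg m hm]
  neg_mem' := fun hf m hm => by simp [hf m hm]

theorem mem_coeffsFrom {n : ℤ} {f : HahnSeries ℤ L} :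
    f ∈ coeffsFrom L n ↔ ∀ m < n, f.coeff m = 0 := Iff.rfl

theorem coeffsFrom_anti {m n : ℤ} (h : m ≤ n) : coeffsFrom L n ≤ coeffsFrom L m :=
  fun _ hf k hk => hf k (hk.trans_le h)

theorem mem_coeffsFrom_iff_exists {n : ℤ} {f : HahnSeries ℤ L} :
    f ∈ coeffsFrom L n ↔ ∃ p : PowerSeries L, f = single n 1 * ofPowerSeries ℤ L p := by
  constructor
  · intro hf
    refine ⟨PowerSeries.mk fun k => f.coeff (n + k), ?_⟩
    ext m
    rw [coeff_single_mul, one_mul, PowerSeries.coeff_coe]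
    split_ifs with h
    · exact hf m (by omega)
    · rw [PowerSeries.coeff_mk]
      congr 1
      omega
  · rintro ⟨p, rfl⟩ m hm
    rw [coeff_single_mul, one_mul, PowerSeries.coeff_coe, if_pos (by omega)]

theorem mul_mem_coeffsFrom {m n : ℤ} {f g : HahnSeries ℤ L} (hf : f ∈ coeffsFrom L m)
    (hg : g ∈ coeffsFrom L n) : f * g ∈ coeffsFrom L (m + n) := by
  rw [mem_coeffsFrom_iff_exists] at *
  obtain ⟨p, rfl⟩ := hf
  obtain ⟨r, rfl⟩ := hg
  exact ⟨p * r, by rw [map_mul, mul_mul_mul_comm, single_mul_single, one_mul]⟩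

theorem exists_mem_coeffsFrom (f : HahnSeries ℤ L) (n : ℤ) : ∃ k : ℕ, f ∈ coeffsFrom L (n - k) :=
  ⟨(n - f.order).toNat, fun _ hm => coeff_eq_zero_of_lt_order (by omega)⟩

theorem C_mem_coeffsFrom (c : L) : (C c : HahnSeries ℤ L) ∈ coeffsFrom L 0 := fun m hm => by
  rw [C_apply, coeff_single_of_ne hm.ne]

/-- The series is `X ^ n` times an invertible power series. -/
def HasUnitLead (f : HahnSeries ℤ L) (n : ℤ) : Prop :=
  ∃ p : (PowerSeries L)ˣ, f = single n 1 * ofPowerSeries ℤ L p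

namespace HasUnitLead

variable {f g : HahnSeries ℤ L} {m n : ℤ}

theorem single_one (n : ℤ) : HasUnitLead (single n (1 : L)) n := ⟨1, by simp⟩

theorem one : HasUnitLead (1 : HahnSeries ℤ L) 0 := single_one 0

/-- Orders need not add up over a ring with zero divisors; they do when the leading coefficients are
units. -/
theorem mul (hf : HasUnitLead f m) (hg : HasUnitLead g n) : HasUnitLead (f * g) (m + n) := by
  obtain ⟨p, rfl⟩ := hf
  obtain ⟨r, rfl⟩ := hg
  exact ⟨p * r, by rw [Units.val_mul, map_mul, mul_mul_mul_comm, single_mul_single, one_mul]⟩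

theorem exists_mul_eq_one (hf : HasUnitLead f n) : ∃ g, HasUnitLead g (-n) ∧ f * g = 1 := by
  obtain ⟨p, rfl⟩ := hf
  refine ⟨_, ⟨p⁻¹, rfl⟩, ?_⟩
  rw [mul_mul_mul_comm, single_mul_single, ← map_mul]
  simp

theorem isUnit (hf : HasUnitLead f n) : IsUnit f := by
  obtain ⟨g, -, h⟩ := hf.exists_mul_eq_one
  exact IsUnit.of_mul_eq_one _ h

theorem inv {f : (HahnSeries ℤ L)ˣ} (hf : HasUnitLead (f : HahnSeries ℤ L) n) :
    HasUnitLead ((f⁻¹ : (HahnSeries ℤ L)ˣ) : HahnSeries ℤ L) (-n) := by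
  obtain ⟨g, hg, h⟩ := hf.exists_mul_eq_one
  rwa [Units.inv_eq_of_mul_eq_one_right h]

theorem pow (hf : HasUnitLead f n) (k : ℕ) : HasUnitLead (f ^ k) (k * n) := by
  induction k with
  | zero => simpa using one
  | succ k ih =>
    rw [pow_succ, show ((k + 1 : ℕ) : ℤ) * n = k * n + n by push_cast; ring]
    exact ih.mul hf

theorem zpow {f : (HahnSeries ℤ L)ˣ} (hf : HasUnitLead (f : HahnSeries ℤ L) n) (k : ℤ) :
    HasUnitLead ((f ^ k : (HahnSeries ℤ L)ˣ) : HahnSeries ℤ L) (k * n) := by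
  obtain ⟨k, rfl | rfl⟩ := k.eq_nat_or_neg
  · simpa using hf.pow k
  · have : HasUnitLead ((f ^ k : (HahnSeries ℤ L)ˣ) : HahnSeries ℤ L) (k * n) := by
      simpa using hf.pow k
    simpa using this.inv

theorem prod {κ : Type*} (s : Finset κ) {f : κ → HahnSeries ℤ L} {n : κ → ℤ}
    (h : ∀ i ∈ s, HasUnitLead (f i) (n i)) : HasUnitLead (∏ i ∈ s, f i) (∑ i ∈ s, n i) := by
  classical
  induction s using Finset.induction_on with
  | empty => exact one
  | insert i s hi ih =>
    rw [Finset.prod_insert hi, Finset.sum_insert hi]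
    exact (h _ (Finset.mem_insert_self _ _)).mul
      (ih fun j hj => h j (Finset.mem_insert_of_mem hj))

theorem mem (hf : HasUnitLead f n) : f ∈ coeffsFrom L n :=
  mem_coeffsFrom_iff_exists.2 (let ⟨p, hp⟩ := hf; ⟨p, hp⟩)

theorem mul_mem_iff (hf : HasUnitLead f n) : f * g ∈ coeffsFrom L (m + n) ↔ g ∈ coeffsFrom L m := by
  constructor
  · intro h
    obtain ⟨f', hf', h1⟩ := hf.exists_mul_eq_one
    have := mul_mem_coeffsFrom hf'.mem h
    rwa [← mul_assoc, mul_comm f', h1, one_mul, neg_add_eq_sub, add_sub_cancel_right] at this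
  · intro h
    rw [add_comm]
    exact mul_mem_coeffsFrom hf.mem h

/-- Leading terms can be removed by multiples of a series with invertible leading coefficient. -/
theorem exists_sub_C_mul_mem (hf : HasUnitLead f n) (hg : g ∈ coeffsFrom L n) :
    ∃ c : L, g - C c * f ∈ coeffsFrom L (n + 1) := by
  obtain ⟨p, rfl⟩ := hf
  obtain ⟨r, rfl⟩ := mem_coeffsFrom_iff_exists.1 hg
  have hp : IsUnit (PowerSeries.constantCoeff (p : PowerSeries L)) :=
    p.isUnit.map PowerSeries.constantCoeff
  obtain ⟨w, hw⟩ := hp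
  refine ⟨PowerSeries.constantCoeff r * ((w⁻¹ : Lˣ) : L), fun m hm => ?_⟩
  rw [mul_left_comm, ← mul_sub, ← ofPowerSeries_C, ← map_mul, ← map_sub, coeff_single_mul, one_mul,
    PowerSeries.coeff_coe]
  split_ifs with h
  · rfl
  · obtain rfl : m = n := by omega
    simp [← hw]

theorem unique [Nontrivial L] (hm : HasUnitLead f m) (hn : HasUnitLead f n) : m = n := by
  have key : ∀ a b : ℤ, HasUnitLead f a → HasUnitLead f b → ¬ a < b := by
    rintro a b ⟨p, rfl⟩ hb hab
    have := hb.mem a hab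
    rw [coeff_single_mul, one_mul, PowerSeries.coeff_coe, if_neg (by omega)] at this
    have hp : IsUnit (PowerSeries.constantCoeff (p : PowerSeries L)) :=
      p.isUnit.map PowerSeries.constantCoeff
    apply hp.ne_zero
    simpa using this
  have := key m n hm hn
  have := key n m hn hm
  omega

end HasUnitLead

theorem hasUnitLead_single_add_C_of_isUnit {n : ℕ} {c : L} (hn : 0 < n) (hc : IsUnit c) :
    HasUnitLead (single (n : ℤ) 1 + C c) 0 := by
  have hu : IsUnit (PowerSeries.X ^ n + PowerSeries.C c : PowerSeries L) := by
    rw [PowerSeries.isUnit_iff_constantCoeff]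
    simpa [hn.ne'] using hc
  obtain ⟨w, hw⟩ := hu
  exact ⟨w, by rw [hw]; simp [ofPowerSeries_C, ofPowerSeries_X_pow]⟩

/-- At infinity, `X⁻¹ + c = X⁻¹ (1 + c X)` for every `c`, with no condition on `c`. -/
theorem hasUnitLead_single_neg_one_add_C (c : L) :
    HasUnitLead (single (-1 : ℤ) 1 + C c) (-1) := by
  have hu : IsUnit (1 + PowerSeries.X * PowerSeries.C c : PowerSeries L) := by
    rw [PowerSeries.isUnit_iff_constantCoeff]
    simp
  obtain ⟨w, hw⟩ := hu
  refine ⟨w, ?_⟩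
  rw [hw, RingHom.map_add, RingHom.map_one, RingHom.map_mul, mul_add, mul_one, ofPowerSeries_X,
    ← mul_assoc, single_mul_single, ofPowerSeries_C, mul_one, neg_add_cancel]
  rw [single_zero_one, one_mul]

end LaurentSeries

end

noncomputable section

open HahnSeries

/-! ### Expansions of the elements of the ring `L[(t + ℓ_i)⁻¹ (i ∈ ι), t]` as Laurent series -/

section Expansion

variable {L : Type v} [CommRing L] {ι : Type} (ℓ : ι → L)

/-- The Laurent series of `t` at the place `t = -ℓ_i` for `some i`, and at infinity for `none`. -/
def placeSeries : Option ι → HahnSeries ℤ L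
  | some i => single 1 1 - C (ℓ i)
  | none => single (-1) 1

/-- The expansions of polynomials at the places `t = -ℓ_i` and at infinity. -/
def polyExpand (o : Option ι) : L[X] →+* HahnSeries ℤ L :=
  Polynomial.eval₂RingHom C (placeSeries ℓ o)

theorem polyExpand_C (o : Option ι) (c : L) : polyExpand ℓ o (Polynomial.C c) = C c := by
  simp [polyExpand]

theorem polyExpand_none_coeff (f : L[X]) (n : ℕ) :
    (polyExpand ℓ none f).coeff (-n) = f.coeff n := by
  induction f using Polynomial.induction_on' with
  | add f g hf hg => rw [map_add, coeff_add, hf, hg, Polynomial.coeff_add]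
  | monomial k a =>
    simp only [polyExpand, placeSeries, Polynomial.coe_eval₂RingHom, Polynomial.eval₂_monomial,
      single_pow, one_pow, Polynomial.coeff_monomial]
    rw [C_mul_eq_smul, coeff_smul, coeff_single]
    simp [eq_comm]

theorem polyExpand_some_eq (i : ι) (f : L[X]) :
    polyExpand ℓ (some i) f =
      ofPowerSeries ℤ L (f.eval₂ PowerSeries.C (PowerSeries.X - PowerSeries.C (ℓ i))) := by
  have h : (ofPowerSeries ℤ L).comp PowerSeries.C = C := RingHom.ext ofPowerSeries_C
  rw [Polynomial.hom_eval₂, map_sub, ofPowerSeries_X, ofPowerSeries_C, h]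
  rfl

theorem polyExpand_some_coeff_zero (i : ι) (f : L[X]) :
    (polyExpand ℓ (some i) f).coeff 0 = f.eval (-ℓ i) := by
  rw [polyExpand_some_eq, PowerSeries.coeff_coe]
  simp only [lt_irrefl, if_false, Int.natAbs_zero, PowerSeries.coeff_zero_eq_constantCoeff]
  rw [Polynomial.hom_eval₂, PowerSeries.constantCoeff_comp_C, map_sub, PowerSeries.constantCoeff_X,
    PowerSeries.constantCoeff_C, zero_sub]
  rfl

theorem polyExpand_some_mem (i : ι) (f : L[X]) :
    polyExpand ℓ (some i) f ∈ coeffsFrom L 0 := by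
  rw [polyExpand_some_eq, mem_coeffsFrom_iff_exists]
  exact ⟨_, by rw [single_zero_one, one_mul]⟩

variable {ℓ} (hℓ : ∀ i j, i ≠ j → IsUnit (ℓ i - ℓ j))
include hℓ in
-- In the parameter `X = t + ℓ_i` the element becomes `X + (ℓ_j - ℓ_i)`, a unit power series for `j
-- ≠ i`. This is where the differences must be invertible.
theorem hasUnitLead_polyExpand_some [DecidableEq ι] (i j : ι) :
    HasUnitLead (polyExpand ℓ (some i) (Polynomial.X + Polynomial.C (ℓ j)))
      ((Pi.single j 1 : ι → ℤ) i) := by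
  have : polyExpand ℓ (some i) (Polynomial.X + Polynomial.C (ℓ j)) =
      single ((1 : ℕ) : ℤ) 1 + C (ℓ j - ℓ i) := by
    simp [polyExpand, placeSeries]
    ring
  rw [this]
  rcases eq_or_ne i j with rfl | h
  · rw [sub_self, C_zero, add_zero, Pi.single_eq_same]
    exact HasUnitLead.single_one 1
  · rw [Pi.single_eq_of_ne h]
    exact hasUnitLead_single_add_C_of_isUnit one_pos (hℓ j i h.symm)

theorem hasUnitLead_polyExpand_none (ℓ : ι → L) (c : L) :
    HasUnitLead (polyExpand ℓ none (Polynomial.X + Polynomial.C c)) (-1) := by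
  have : polyExpand ℓ none (Polynomial.X + Polynomial.C c) = single (-1 : ℤ) 1 + C c := by
    simp [polyExpand, placeSeries]
  rw [this]
  exact hasUnitLead_single_neg_one_add_C c

include hℓ in
theorem isUnit_polyExpand (o : Option ι)
    (s : Submonoid.closure (Set.range fun i => (Polynomial.X + Polynomial.C (ℓ i) : L[X]))) :
    IsUnit (polyExpand ℓ o s) := by
  classical
  obtain ⟨s, hs⟩ := s
  induction hs using Submonoid.closure_induction with
  | mem x hx =>
    obtain ⟨j, rfl⟩ := hx
    cases o with
    | none => exact (hasUnitLead_polyExpand_none ℓ _).isUnit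
    | some i => exact (hasUnitLead_polyExpand_some hℓ i j).isUnit
  | one => simp
  | mul x y _ _ hx hy =>
    simpa using hx.mul hy

/-- The Laurent series expansions at the places `t = -ℓ_i` and at infinity. -/
def expand (o : Option ι) : LaurentRing ℓ →+* HahnSeries ℤ L :=
  IsLocalization.lift (isUnit_polyExpand hℓ o)

theorem expand_algebraMap (o : Option ι) (f : L[X]) :
    expand hℓ o (algebraMap L[X] _ f) = polyExpand ℓ o f :=
  IsLocalization.lift_eq _ _

theorem expand_constCoeff (o : Option ι) (c : L) : expand hℓ o (constCoeff ℓ c) = C c := by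
  rw [constCoeff, expand_algebraMap, polyExpand_C]

variable [Fintype ι]

/-- The unit `∏ i, (t + ℓ_i) ^ k_i`. -/
def monomialUnit (ℓ : ι → L) (k : ι → ℤ) : (LaurentRing ℓ)ˣ := ∏ i, tAdd ℓ i ^ k i

theorem monomialUnit_add (k m : ι → ℤ) :
    monomialUnit ℓ (k + m) = monomialUnit ℓ k * monomialUnit ℓ m := by
  simp [monomialUnit, zpow_add, Finset.prod_mul_distrib]

theorem monomialUnit_neg (k : ι → ℤ) : monomialUnit ℓ (-k) = (monomialUnit ℓ k)⁻¹ := by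
  simp [monomialUnit]

theorem monomialUnit_zero : monomialUnit ℓ 0 = 1 := by simp [monomialUnit]

theorem monomialUnit_single [DecidableEq ι] (i : ι) (n : ℤ) :
    monomialUnit ℓ (Pi.single i n) = tAdd ℓ i ^ n := by
  rw [monomialUnit, Finset.prod_eq_single i]
  · simp
  · intro j _ hj
    simp [Pi.single_eq_of_ne hj]
  · simp

/-- The valuation of `∏ i, (t + ℓ_i) ^ k_i` at the place `t = -ℓ_i`, and at infinity. -/
def placeVal (k : ι → ℤ) : Option ι → ℤ
  | some i => k i
  | none => -∑ i, k i

theorem placeVal_add (k m : ι → ℤ) (o : Option ι) :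
    placeVal (k + m) o = placeVal k o + placeVal m o := by
  cases o <;> simp [placeVal, Finset.sum_add_distrib]; ring

theorem placeVal_neg (k : ι → ℤ) (o : Option ι) : placeVal (-k) o = -placeVal k o := by
  cases o <;> simp [placeVal]

/-- The product formula; together with `exists_placeVal_eq` it identifies exponent vectors with the
height vectors of vertices of the Diestel-Leader graph. -/
theorem sum_placeVal (k : ι → ℤ) : ∑ o, placeVal k o = 0 := by
  simp [Fintype.sum_option, placeVal]

theorem placeVal_injective : Function.Injective (placeVal : (ι → ℤ) → Option ι → ℤ) :=
  fun _ _ h => funext fun i => congrFun h (some i)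

theorem exists_placeVal_eq {n : Option ι → ℤ} (h : ∑ o, n o = 0) : ∃ k, placeVal k = n := by
  refine ⟨fun i => n (some i), funext fun o => ?_⟩
  rw [Fintype.sum_option] at h
  cases o
  · simp only [placeVal]; omega
  · rfl

theorem exists_placeVal_apply_eq [Nonempty ι] (o : Option ι) (n : ℤ) :
    ∃ k : ι → ℤ, placeVal k o = n := by
  classical
  cases o with
  | some i => exact ⟨fun _ => n, rfl⟩
  | none =>
    obtain ⟨i⟩ := ‹Nonempty ι›
    exact ⟨Pi.single i (-n), by simp [placeVal]⟩

theorem hasUnitLead_expand_monomialUnit (o : Option ι) (k : ι → ℤ) :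
    HasUnitLead (expand hℓ o (monomialUnit ℓ k)) (placeVal k o) := by
  classical
  have h1 : (expand hℓ o (monomialUnit ℓ k)) =
      ∏ i, ((Units.map (expand hℓ o : LaurentRing ℓ →* HahnSeries ℤ L) (tAdd ℓ i) ^ k i :
        (HahnSeries ℤ L)ˣ) : HahnSeries ℤ L) := by
    rw [monomialUnit, Units.coe_prod, map_prod]
    refine Finset.prod_congr rfl fun i _ => ?_
    rw [← map_zpow]
    rfl
  have h2 : ∀ i, (Units.map (expand hℓ o : LaurentRing ℓ →* HahnSeries ℤ L) (tAdd ℓ i) :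
      HahnSeries ℤ L) = polyExpand ℓ o (Polynomial.X + Polynomial.C (ℓ i)) := fun i => by
    rw [← expand_algebraMap hℓ]
    rfl
  rw [h1]
  cases o with
  | none =>
    have : placeVal k none = ∑ i, k i * (-1) := by simp [placeVal]
    rw [this]
    refine HasUnitLead.prod _ fun i _ => HasUnitLead.zpow ?_ _
    rw [h2]
    exact hasUnitLead_polyExpand_none ℓ _
  | some j =>
    have : placeVal k (some j) = ∑ i, k i * (Pi.single i 1 : ι → ℤ) j := by
      simp [placeVal, Pi.single_apply]
    rw [this]
    refine HasUnitLead.prod _ fun i _ => HasUnitLead.zpow ?_ _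
    rw [h2]
    exact hasUnitLead_polyExpand_some hℓ _ _

theorem monomialUnit_injective [Nontrivial L] (hℓ : ∀ i j, i ≠ j → IsUnit (ℓ i - ℓ j)) :
    Function.Injective (monomialUnit ℓ) := by
  intro k m h
  refine placeVal_injective (funext fun o => ?_)
  have h1 := hasUnitLead_expand_monomialUnit hℓ o k
  rw [h] at h1
  exact h1.unique (hasUnitLead_expand_monomialUnit hℓ o m)

end Expansion

/-! ### The filtrations of the ring by order of vanishing, and partial fractions -/

section Filtration

variable {L : Type v} [CommRing L] {ι : Type} {ℓ : ι → L}
  (hℓ : ∀ i j, i ≠ j → IsUnit (ℓ i - ℓ j))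

/-- The normalization of the orders of vanishing: it is shifted by one at infinity. -/
def placeShift : Option ι → ℤ
  | some _ => 0
  | none => 1

/-- The expansion at a place, divided by `X` at infinity. -/
def expandShift (o : Option ι) : LaurentRing ℓ →+ HahnSeries ℤ L :=
  (AddMonoidHom.mulLeft (single (-placeShift o) 1)).comp (expand hℓ o).toAddMonoidHom

theorem expandShift_apply (o : Option ι) (P : LaurentRing ℓ) :
    expandShift hℓ o P = single (-placeShift o) 1 * expand hℓ o P := rfl

theorem expandShift_mul (o : Option ι) (P Q : LaurentRing ℓ) :
    expandShift hℓ o (P * Q) = expand hℓ o P * expandShift hℓ o Q := by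
  rw [expandShift_apply, expandShift_apply, map_mul, mul_left_comm]

theorem expandShift_some (i : ι) (P : LaurentRing ℓ) :
    expandShift hℓ (some i) P = expand hℓ (some i) P := by
  simp [expandShift_apply, placeShift]

/-- The elements vanishing to order `n` (to order `n + 1` at infinity). -/
def vanishing (o : Option ι) (n : ℤ) : AddSubgroup (LaurentRing ℓ) :=
  (coeffsFrom L n).comap (expandShift hℓ o)

theorem mem_vanishing {o : Option ι} {n : ℤ} {P : LaurentRing ℓ} :
    P ∈ vanishing hℓ o n ↔ expandShift hℓ o P ∈ coeffsFrom L n := Iff.rfl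

theorem vanishing_anti (o : Option ι) {m n : ℤ} (h : m ≤ n) :
    vanishing hℓ o n ≤ vanishing hℓ o m :=
  fun _ hP => coeffsFrom_anti h hP

/-- Only finitely many degrees below `n` matter, and the terms are cancelled from the lowest
upwards. Taking `A = ⊤` gives density at one place; taking for `A` the elements regular at the other
places gives principal parts. -/
theorem exists_mem_sub_expandShift_mem (o : Option ι) (A : AddSubgroup (LaurentRing ℓ)) (n : ℤ)
    (hA : ∀ m < n, ∃ e, HasUnitLead (expandShift hℓ o e) m ∧ ∀ c, constCoeff ℓ c * e ∈ A)
    (f : HahnSeries ℤ L) : ∃ P ∈ A, f - expandShift hℓ o P ∈ coeffsFrom L n := by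
  obtain ⟨k, hk⟩ := exists_mem_coeffsFrom f n
  induction k generalizing f with
  | zero => exact ⟨0, A.zero_mem, by simpa using hk⟩
  | succ k ih =>
    obtain ⟨e, he, heA⟩ := hA (n - (k + 1 : ℕ)) (by push_cast; omega)
    obtain ⟨c, hc⟩ := he.exists_sub_C_mul_mem hk
    rw [show n - (k + 1 : ℕ) + 1 = n - k by push_cast; ring] at hc
    obtain ⟨P, hPA, hP⟩ := ih _ hc
    refine ⟨constCoeff ℓ c * e + P, A.add_mem (heA c) hPA, ?_⟩
    rwa [map_add, expandShift_mul, expand_constCoeff, ← sub_sub]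

theorem constCoeff_mul_mem_vanishing {o : Option ι} {n : ℤ} {P : LaurentRing ℓ} (c : L)
    (hP : P ∈ vanishing hℓ o n) : constCoeff ℓ c * P ∈ vanishing hℓ o n := by
  rw [mem_vanishing, expandShift_mul, expand_constCoeff]
  simpa using mul_mem_coeffsFrom (C_mem_coeffsFrom c) hP

variable [Fintype ι]

theorem monomialUnit_mul_mem_vanishing {o : Option ι} {n : ℤ} {k : ι → ℤ} {P : LaurentRing ℓ} :
    monomialUnit ℓ k * P ∈ vanishing hℓ o (n + placeVal k o) ↔ P ∈ vanishing hℓ o n := by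
  rw [mem_vanishing, mem_vanishing, expandShift_mul]
  exact (hasUnitLead_expand_monomialUnit hℓ o k).mul_mem_iff

theorem hasUnitLead_expandShift_monomialUnit (o : Option ι) (k : ι → ℤ) :
    HasUnitLead (expandShift hℓ o (monomialUnit ℓ k)) (placeVal k o - placeShift o) := by
  rw [sub_eq_neg_add]
  exact (HasUnitLead.single_one _).mul (hasUnitLead_expand_monomialUnit hℓ o k)

theorem exists_sub_expandShift_mem [Nonempty ι] (o : Option ι) (n : ℤ) (f : HahnSeries ℤ L) :
    ∃ P, f - expandShift hℓ o P ∈ coeffsFrom L n := by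
  obtain ⟨P, -, hP⟩ := exists_mem_sub_expandShift_mem hℓ o ⊤ n (fun m _ => by
    obtain ⟨k, hk⟩ := exists_placeVal_apply_eq o (m + placeShift o)
    refine ⟨monomialUnit ℓ k, ?_, fun _ => AddSubgroup.mem_top _⟩
    have := hasUnitLead_expandShift_monomialUnit hℓ o k
    rwa [hk, add_sub_cancel_right] at this) f
  exact ⟨P, hP⟩

/-- Denominators are cancelled one factor at a time: if `(t + ℓ_i) P` is a polynomial `f` and `P`
has no pole at `-ℓ_i`, then `f(-ℓ_i) = 0` and `t + ℓ_i` divides `f`. -/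
theorem mem_range_of_forall_mem_vanishing (P : LaurentRing ℓ)
    (hP : ∀ i, P ∈ vanishing hℓ (some i) 0) : ∃ f : L[X], algebraMap L[X] _ f = P := by
  classical
  obtain ⟨⟨f, s, hs⟩, h⟩ := IsLocalization.surj
    (Submonoid.closure (Set.range fun i => (Polynomial.X + Polynomial.C (ℓ i) : L[X]))) P
  replace h : ∃ f : L[X], P * algebraMap L[X] _ s = algebraMap L[X] _ f := ⟨f, h⟩
  clear f
  induction hs using Submonoid.closure_induction_left generalizing P with
  | one =>
    obtain ⟨f, hf⟩ := h
    exact ⟨f, by rw [← hf, map_one, mul_one]⟩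
  | mul_left x hx s hs ih =>
    obtain ⟨i, rfl⟩ := hx
    have hmon : monomialUnit ℓ (Pi.single i 1) * P =
        P * algebraMap L[X] _ (Polynomial.X + Polynomial.C (ℓ i)) := by
      rw [monomialUnit_single, zpow_one, tAdd_val, mul_comm]
    have hmem : ∀ j, monomialUnit ℓ (Pi.single i 1) * P ∈
        vanishing hℓ (some j) (0 + (Pi.single i 1 : ι → ℤ) j) := fun j =>
      (monomialUnit_mul_mem_vanishing hℓ (k := Pi.single i 1)).2 (hP j)
    obtain ⟨f, hf⟩ := ih (monomialUnit ℓ (Pi.single i 1) * P)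
      (fun j => vanishing_anti hℓ _ (by rw [Pi.single_apply]; split_ifs <;> simp) (hmem j))
      (by
        obtain ⟨f, hf⟩ := h
        exact ⟨f, by rw [hmon, mul_assoc, ← map_mul, hf]⟩)
    have h0 := hmem i
    rw [← hf, mem_vanishing, expandShift_some, expand_algebraMap] at h0
    have h1 := h0 0 (by simp)
    rw [polyExpand_some_coeff_zero] at h1
    obtain ⟨g, rfl⟩ := Polynomial.dvd_iff_isRoot.2 h1
    refine ⟨g, ?_⟩
    rw [map_mul, hmon, mul_comm P, Polynomial.C_neg, sub_neg_eq_add, ← tAdd_val] at hf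
    exact (Units.mul_right_inj _).1 hf

/-- Regularity at the finite places leaves a polynomial; vanishing at infinity, built into the
shift, then kills every coefficient, including the constant one. -/
theorem eq_zero_of_forall_mem_vanishing {P : LaurentRing ℓ} (hP : ∀ o, P ∈ vanishing hℓ o 0) :
    P = 0 := by
  obtain ⟨f, rfl⟩ := mem_range_of_forall_mem_vanishing hℓ P fun i => hP (some i)
  have : f = 0 := by
    ext n
    have h := hP none (-n - 1) (by omega)
    rw [expandShift_apply, coeff_single_mul, one_mul, expand_algebraMap] at h
    rw [← polyExpand_none_coeff ℓ, Polynomial.coeff_zero]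
    convert h using 2
    simp [placeShift]
  rw [this, map_zero]

/-- The principal part of `Q` at `o`: a polynomial in `t` at infinity, a polynomial in `(t + ℓ_i)⁻¹`
without constant term at `-ℓ_i`. -/
theorem exists_sub_mem_vanishing_of_place [DecidableEq ι] (o : Option ι) (Q : LaurentRing ℓ) :
    ∃ P, Q - P ∈ vanishing hℓ o 0 ∧ ∀ o', o' ≠ o → P ∈ vanishing hℓ o' 0 := by
  obtain ⟨P, hP, hQ⟩ := exists_mem_sub_expandShift_mem hℓ o
    (⨅ o' : {o' // o' ≠ o}, vanishing hℓ (o' : Option ι) 0) 0 (fun m hm => by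
      cases o with
      | none =>
        -- As `t = X⁻¹` and the shift divides by `X`, the power `t ^ (-m - 1)` has order `m`.
        refine ⟨algebraMap L[X] _ (Polynomial.X ^ (-m - 1).toNat), ?_, fun c => ?_⟩
        · rw [expandShift_apply, expand_algebraMap, map_pow]
          have : HasUnitLead (polyExpand ℓ none Polynomial.X) (-1) := by
            simpa using hasUnitLead_polyExpand_none ℓ 0
          convert (HasUnitLead.single_one (L := L) _).mul (this.pow (-m - 1).toNat) using 1
          simp only [placeShift]
          omega
        · rw [AddSubgroup.mem_iInf]
          rintro ⟨_ | i, ho⟩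
          · exact (ho rfl).elim
          · refine constCoeff_mul_mem_vanishing hℓ _ ?_
            rw [mem_vanishing, expandShift_some, expand_algebraMap]
            exact polyExpand_some_mem _ _ _
      | some i =>
        have hlead := fun o => hasUnitLead_expandShift_monomialUnit hℓ o (Pi.single i m)
        refine ⟨monomialUnit ℓ (Pi.single i m), ?_, fun c => ?_⟩
        · simpa [placeVal, placeShift] using hlead (some i)
        · rw [AddSubgroup.mem_iInf]
          rintro ⟨o', ho⟩
          refine constCoeff_mul_mem_vanishing hℓ _ (coeffsFrom_anti ?_ (hlead o').mem)
          cases o' with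
          | none => simp [placeVal, placeShift]; omega
          | some j =>
            have : j ≠ i := fun h => ho (congrArg some h)
            simp [placeVal, placeShift, this]) (expandShift hℓ o Q)
  refine ⟨P, ?_, fun o' ho' => (AddSubgroup.mem_iInf.1 hP) ⟨o', ho'⟩⟩
  rwa [mem_vanishing, map_sub]

/-- Simultaneous approximation: dividing by `monomialUnit ℓ k` reduces to order `0` everywhere,
where the sum of the principal parts works. -/
theorem exists_forall_sub_mem_vanishing (k : ι → ℤ) (Q : Option ι → LaurentRing ℓ) :
    ∃ P, ∀ o, P - Q o ∈ vanishing hℓ o (placeVal k o) := by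
  classical
  choose p hp hp' using fun o => exists_sub_mem_vanishing_of_place hℓ o
    (((monomialUnit ℓ k)⁻¹ : (LaurentRing ℓ)ˣ) * Q o)
  refine ⟨monomialUnit ℓ k * ∑ o, p o, fun o => ?_⟩
  have h : monomialUnit ℓ k * ∑ o, p o - Q o = monomialUnit ℓ k *
      (∑ o, p o - ((monomialUnit ℓ k)⁻¹ : (LaurentRing ℓ)ˣ) * Q o) := by
    rw [mul_sub, Units.mul_inv_cancel_left]
  have h2 := monomialUnit_mul_mem_vanishing hℓ (o := o) (n := 0) (k := k)
    (P := ∑ o, p o - ((monomialUnit ℓ k)⁻¹ : (LaurentRing ℓ)ˣ) * Q o)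
  rw [zero_add] at h2
  rw [h, h2, ← Finset.add_sum_erase _ _ (Finset.mem_univ o), add_sub_right_comm]
  refine AddSubgroup.add_mem _ ?_ (AddSubgroup.sum_mem _ fun o' ho' => ?_)
  · rw [← neg_sub]
    exact AddSubgroup.neg_mem _ (hp o)
  · exact hp' o' o (Finset.ne_of_mem_erase ho').symm

/-- The tree at the place `o`: `Θ n P` is the ball of level `n` around `P`. -/
theorem exists_laurentRing_coordinates [Nonempty ι] [Finite L] {q : ℕ} (hL : Nat.card L = q)
    (T : HorocyclicTree.{u} q) (o : Option ι) :
    ∃ Θ : ℤ → LaurentRing ℓ → T.V,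
      (∀ n P, T.hor (Θ n P) = n) ∧ (∀ n P, T.pred (Θ n P) = Θ (n - 1) P) ∧
      (∀ n P Q, Θ n P = Θ n Q ↔ P - Q ∈ vanishing hℓ o n) ∧ ∀ x, ∃ P, Θ (T.hor x) P = x := by
  obtain ⟨Θ, h1, h2, h3, h4⟩ := T.exists_laurentSeries_coordinates hL
  have h5 : ∀ n f g, Θ n f = Θ n g ↔ f - g ∈ coeffsFrom L n := fun n f g => by
    rw [h3, mem_coeffsFrom]
    simp [sub_eq_zero]
  refine ⟨fun n P => Θ n (expandShift hℓ o P), fun n P => h1 _ _, fun n P => h2 _ _,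
    fun n P Q => ?_, fun x => ?_⟩
  · rw [h5, mem_vanishing, map_sub]
  · obtain ⟨f, hf⟩ := h4 x
    obtain ⟨P, hP⟩ := exists_sub_expandShift_mem hℓ o (T.hor x) f
    exact ⟨P, ((h5 _ _ _).2 hP).symm.trans hf⟩

end Filtration

end

noncomputable section

/-! ### The generators, uniformly in the places -/

section Generators

variable {L : Type v} [CommRing L] {ι : Type} [DecidableEq ι] {ℓ : ι → L}

/-- The exponents of `t + ℓ_i` for `some i`, and of `1` for `none`. -/
def placeExp : Option ι → ι → ℤ
  | some i => Pi.single i 1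
  | none => 0

variable [Fintype ι]

/-- The shift cancels in `placeExp o - placeExp o'`, whose valuations are therefore `1` at `o`, `-1`
at `o'` and `0` elsewhere, if `o ≠ o'`. -/
theorem placeVal_placeExp (o o' : Option ι) :
    placeVal (placeExp o) o' = (if o' = o then 1 else 0) - placeShift o' := by
  cases o <;> cases o' <;> simp [placeVal, placeExp, placeShift, Pi.single_apply]

theorem affMat_injective {R : Type v} [CommRing R] {a b : Rˣ} {P Q : R}
    (h : affMat a P = affMat b Q) : a = b ∧ P = Q := by
  have h' := congrArg Units.val h
  constructor
  · ext
    simpa [affMat] using congrFun (congrFun h' 0) 0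
  · simpa [affMat] using congrFun (congrFun h' 0) 1

/-- With the factor `1` assigned to infinity, the three families become one, indexed by ordered
pairs of distinct places. -/
theorem mem_genMatrices_iff {g : GL (Fin 2) (LaurentRing ℓ)} :
    g ∈ genMatrices ℓ ↔ ∃ (o o' : Option ι) (b : L), o ≠ o' ∧
      g = affMat (monomialUnit ℓ (placeExp o - placeExp o'))
        (constCoeff ℓ b * (monomialUnit ℓ (-placeExp o') : (LaurentRing ℓ)ˣ)) := by
  have hneg : ∀ b, constCoeff ℓ (-b) = -constCoeff ℓ b := fun b => by simp [constCoeff]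
  simp only [sub_eq_add_neg, monomialUnit_add, monomialUnit_neg]
  have hs : ∀ i, monomialUnit ℓ (placeExp (some i)) = tAdd ℓ i := fun i => by
    simp [placeExp, monomialUnit_single]
  have hn : monomialUnit ℓ (placeExp none) = 1 := monomialUnit_zero
  constructor
  · rintro (⟨i, b, rfl | rfl⟩ | ⟨i, j, b, hij, rfl⟩)
    · exact ⟨some i, none, b, by simp, by simp [hs, hn]⟩
    · exact ⟨none, some i, -b, by simp, by rw [affMat_inv]; simp [hs, hn, hneg, mul_comm]⟩
    · exact ⟨some i, some j, -b, by simpa using hij, by simp [hs, hneg]⟩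
  · rintro ⟨_ | i, _ | j, b, hne, rfl⟩
    · exact (hne rfl).elim
    · exact Or.inl ⟨j, -b, Or.inr (by rw [affMat_inv]; simp [hs, hn, hneg, mul_comm])⟩
    · exact Or.inl ⟨i, b, Or.inl (by simp [hs, hn])⟩
    · exact Or.inr ⟨i, j, -b, fun h => hne (congrArg some h), by simp [hs, hneg]⟩

omit [DecidableEq ι] in
theorem inv_mem_genMatrices {g : GL (Fin 2) (LaurentRing ℓ)} (hg : g ∈ genMatrices ℓ) :
    g⁻¹ ∈ genMatrices ℓ := by
  classical
  rw [mem_genMatrices_iff] at *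
  obtain ⟨o, o', b, hne, rfl⟩ := hg
  refine ⟨o', o, -b, hne.symm, ?_⟩
  rw [affMat_inv, ← monomialUnit_neg, neg_sub]
  congr 1
  rw [neg_mul, mul_left_comm, ← Units.val_mul, ← monomialUnit_add,
    show placeExp o' - placeExp o + -placeExp o' = -placeExp o by abel]
  simp [constCoeff]

omit [DecidableEq ι] in
theorem one_notMem_genMatrices [Nontrivial L] (hℓ : ∀ i j, i ≠ j → IsUnit (ℓ i - ℓ j)) :
    1 ∉ genMatrices ℓ := by
  classical
  rw [mem_genMatrices_iff]
  rintro ⟨o, o', b, hne, h⟩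
  rw [← affMat_one] at h
  have h1 := (affMat_injective h).1
  rw [← monomialUnit_zero (ℓ := ℓ)] at h1
  have h2 := congrArg (placeVal · o) (sub_eq_zero.1 (monomialUnit_injective hℓ h1).symm)
  simp only [placeVal_placeExp] at h2
  simp [hne] at h2

/-- The generators are the translates of level one at a place. -/
theorem forall_mem_vanishing_iff (hℓ : ∀ i j, i ≠ j → IsUnit (ℓ i - ℓ j)) {o : Option ι}
    {k : ι → ℤ} {P : LaurentRing ℓ} :
    ((∀ o' ≠ o, P ∈ vanishing hℓ o' (placeVal k o')) ∧ P ∈ vanishing hℓ o (placeVal k o - 1)) ↔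
      ∃ b, P = monomialUnit ℓ k * (constCoeff ℓ b * (monomialUnit ℓ (-placeExp o))) := by
  obtain ⟨Q, rfl⟩ : ∃ Q, P = monomialUnit ℓ k * Q := ⟨_, (Units.mul_inv_cancel_left _ P).symm⟩
  have hk : ∀ (o : Option ι) (n : ℤ), monomialUnit ℓ k * Q ∈ vanishing hℓ o (n + placeVal k o) ↔
      Q ∈ vanishing hℓ o n := fun o n => monomialUnit_mul_mem_vanishing hℓ
  have hk0 : ∀ o : Option ι, monomialUnit ℓ k * Q ∈ vanishing hℓ o (placeVal k o) ↔
      Q ∈ vanishing hℓ o 0 := fun o => by rw [← hk, zero_add]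
  have hlead : ∀ o', HasUnitLead (expandShift hℓ o' (monomialUnit ℓ (-placeExp o)))
      (if o' = o then -1 else 0) := fun o' => by
    convert hasUnitLead_expandShift_monomialUnit hℓ o' (-placeExp o) using 1
    rw [placeVal_neg, placeVal_placeExp]
    split_ifs <;> ring
  have hbmem : ∀ o' ≠ o, ∀ b, constCoeff ℓ b * monomialUnit ℓ (-placeExp o) ∈
      vanishing hℓ o' 0 := fun o' ho' b => by
    have := hlead o'
    rw [if_neg ho'] at this
    exact constCoeff_mul_mem_vanishing hℓ b this.mem
  have ho := hlead o
  rw [if_pos rfl] at ho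
  simp only [hk0, sub_eq_neg_add _ (1 : ℤ), hk, Units.mul_right_inj]
  constructor
  · rintro ⟨h1, h2⟩
    -- A multiple of the one allowed element removes the term of order `-1` at `o`; the remainder
    -- has no principal part anywhere and is zero.
    obtain ⟨b, hb⟩ := ho.exists_sub_C_mul_mem h2
    refine ⟨b, sub_eq_zero.1 (eq_zero_of_forall_mem_vanishing hℓ fun o' => ?_)⟩
    by_cases h : o' = o
    · subst h
      rwa [mem_vanishing, map_sub, expandShift_mul, expand_constCoeff]
    · exact AddSubgroup.sub_mem _ (h1 o' h) (hbmem o' h b)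
  · rintro ⟨b, rfl⟩
    exact ⟨fun o' h => hbmem o' h b, constCoeff_mul_mem_vanishing hℓ b ho.mem⟩

end Generators

/-! ### The matrices generate the affine group -/

section Generation

variable {L : Type v} [CommRing L] {ι : Type} {ℓ : ι → L}

/-- The embedding of the units of a ring into its group of affine matrices. -/
def affDiag (R : Type v) [CommRing R] : Rˣ →* GL (Fin 2) R where
  toFun a := affMat a 0
  map_one' := affMat_one
  map_mul' a b := by rw [affMat_mul]; simp

/-- The translations in a group of affine matrices. -/
def translations {R : Type v} [CommRing R] (H : Subgroup (GL (Fin 2) R)) : AddSubgroup R where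
  carrier := {P | affMat 1 P ∈ H}
  zero_mem' := by
    rw [Set.mem_ofPred_eq, affMat_one]
    exact H.one_mem
  add_mem' := fun {P Q} hP hQ => by
    have := H.mul_mem hQ hP
    rw [affMat_mul] at this
    simpa using this
  neg_mem' := fun {P} hP => by
    have := H.inv_mem hP
    rw [affMat_inv] at this
    simpa using this

theorem mem_translations {R : Type v} [CommRing R] {H : Subgroup (GL (Fin 2) R)} {P : R} :
    P ∈ translations H ↔ affMat 1 P ∈ H := Iff.rfl

/-- Conjugating a translation by a diagonal matrix scales it. -/
theorem mul_mem_translations {R : Type v} [CommRing R] {H : Subgroup (GL (Fin 2) R)} {a : Rˣ}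
    {P : R} (ha : a ∈ H.comap (affDiag R)) (hP : P ∈ translations H) :
    (a : R) * P ∈ translations H := by
  have := H.mul_mem (H.mul_mem ha hP) (H.inv_mem ha)
  simp only [affDiag, MonoidHom.coe_mk, OneHom.coe_mk, affMat_inv, affMat_mul] at this
  rw [mem_translations]
  simpa using this

theorem tAdd_mem_comap_closure (i : ι) :
    tAdd ℓ i ∈ (Subgroup.closure (genMatrices ℓ)).comap (affDiag _) := by
  refine Subgroup.subset_closure (Or.inl ⟨i, 0, Or.inl ?_⟩)
  simp [affDiag, constCoeff]

theorem constCoeff_mem_translations [Nonempty ι] (b : L) :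
    constCoeff ℓ b ∈ translations (Subgroup.closure (genMatrices ℓ)) := by
  obtain ⟨i⟩ := ‹Nonempty ι›
  have h : affMat (tAdd ℓ i) (constCoeff ℓ b) ∈ Subgroup.closure (genMatrices ℓ) :=
    Subgroup.subset_closure (Or.inl ⟨i, b, Or.inl rfl⟩)
  have := Subgroup.mul_mem _ h (Subgroup.inv_mem _ (tAdd_mem_comap_closure (ℓ := ℓ) i))
  simp only [affDiag, MonoidHom.coe_mk, OneHom.coe_mk, affMat_inv, affMat_mul] at this
  rw [mem_translations]
  simpa using this

/-- Polynomials are expanded in powers of `t + ℓ_i`, since `t` itself need not be a unit. -/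
theorem algebraMap_mem_translations [Nonempty ι] (f : L[X]) :
    algebraMap L[X] (LaurentRing ℓ) f ∈ translations (Subgroup.closure (genMatrices ℓ)) := by
  obtain ⟨i⟩ := id ‹Nonempty ι›
  have key : ∀ g : L[X], algebraMap L[X] (LaurentRing ℓ)
      (g.comp (Polynomial.X + Polynomial.C (ℓ i))) ∈
        translations (Subgroup.closure (genMatrices ℓ)) := by
    intro g
    induction g using Polynomial.induction_on' with
    | add g h hg hh =>
      rw [Polynomial.add_comp, map_add]
      exact AddSubgroup.add_mem _ hg hh
    | monomial n a =>
      rw [Polynomial.monomial_comp, map_mul, map_pow, ← tAdd_val, mul_comm,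
        ← Units.val_pow_eq_pow_val]
      exact mul_mem_translations (Subgroup.pow_mem _ (tAdd_mem_comap_closure i) n)
        (constCoeff_mem_translations a)
  have := key (f.comp (Polynomial.X - Polynomial.C (ℓ i)))
  rw [Polynomial.comp_assoc] at this
  simpa using this

theorem translations_closure_genMatrices [Nonempty ι] (P : LaurentRing ℓ) :
    P ∈ translations (Subgroup.closure (genMatrices ℓ)) := by
  obtain ⟨⟨f, s, hs⟩, h⟩ := IsLocalization.surj
    (Submonoid.closure (Set.range fun i => (Polynomial.X + Polynomial.C (ℓ i) : L[X]))) P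
  dsimp only at h
  obtain ⟨w, hw, hwH⟩ : ∃ w : (LaurentRing ℓ)ˣ, (w : LaurentRing ℓ) = algebraMap L[X] _ s ∧
      w ∈ (Subgroup.closure (genMatrices ℓ)).comap (affDiag _) := by
    clear h
    induction hs using Submonoid.closure_induction with
    | mem x hx =>
      obtain ⟨i, rfl⟩ := hx
      exact ⟨tAdd ℓ i, rfl, tAdd_mem_comap_closure i⟩
    | one => exact ⟨1, by simp, Subgroup.one_mem _⟩
    | mul x y _ _ hx hy =>
      obtain ⟨a, ha, haH⟩ := hx
      obtain ⟨b, hb, hbH⟩ := hy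
      exact ⟨a * b, by simp [ha, hb], Subgroup.mul_mem _ haH hbH⟩
  have h1 : P = ((w⁻¹ : (LaurentRing ℓ)ˣ) : LaurentRing ℓ) * algebraMap L[X] _ f := by
    rw [← h, ← hw, mul_comm P, Units.inv_mul_cancel_left]
  rw [h1]
  exact mul_mem_translations (Subgroup.inv_mem _ hwH) (algebraMap_mem_translations f)

theorem closure_affGens [Fintype ι] [Nonempty ι] : Subgroup.closure (affGens ℓ) = ⊤ := by
  have himg : (affGroup ℓ).subtype '' affGens ℓ = genMatrices ℓ := by
    ext g
    constructor
    · rintro ⟨g, hg, rfl⟩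
      exact hg
    · exact fun hg => ⟨⟨g, genMatrices_subset ℓ hg⟩, hg, rfl⟩
  rw [eq_top_iff]
  rintro ⟨g, hmk⟩ -
  obtain ⟨k, P, rfl⟩ := id hmk
  have hmem : affMat (∏ i, tAdd ℓ i ^ k i) P ∈ Subgroup.closure (genMatrices ℓ) := by
    have h1 : ∏ i, tAdd ℓ i ^ k i ∈ (Subgroup.closure (genMatrices ℓ)).comap (affDiag _) :=
      Subgroup.prod_mem _ fun i _ => Subgroup.zpow_mem _ (tAdd_mem_comap_closure i) _
    have h2 := Subgroup.mul_mem _ (mem_translations.1 (translations_closure_genMatrices P))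
      (Subgroup.mem_comap.1 h1)
    simpa only [affDiag, MonoidHom.coe_mk, OneHom.coe_mk, affMat_mul, one_mul, mul_zero, zero_add]
      using h2
  rw [← himg, ← MonoidHom.map_closure] at hmem
  obtain ⟨x, hx, hxg⟩ := hmem
  obtain rfl : x = ⟨_, hmk⟩ := Subtype.ext hxg
  exact hx

end Generation

/-! ### The isomorphism -/

section Isomorphism

variable {L : Type v} [CommRing L] {ι : Type} [Fintype ι] {ℓ : ι → L}

/-- The elements of the affine group are given by the exponents `k_i` and the entry `P`. -/
def affGroupEquiv [Nontrivial L] (hℓ : ∀ i j, i ≠ j → IsUnit (ℓ i - ℓ j)) :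
    (ι → ℤ) × LaurentRing ℓ ≃ affGroup ℓ :=
  Equiv.ofBijective (fun p => ⟨affMat (monomialUnit ℓ p.1) p.2, p.1, p.2, rfl⟩) <| by
    constructor
    · rintro ⟨k, P⟩ ⟨m, Q⟩ h
      obtain ⟨h1, h2⟩ := affMat_injective (congrArg Subtype.val h)
      exact Prod.ext (monomialUnit_injective hℓ h1) h2
    · rintro ⟨_, k, P, rfl⟩
      exact ⟨(k, P), rfl⟩

theorem mulCayley_affGens_adj [DecidableEq ι] [Nontrivial L]
    (hℓ : ∀ i j, i ≠ j → IsUnit (ℓ i - ℓ j)) {k m : ι → ℤ} {P Q : LaurentRing ℓ} :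
    (SimpleGraph.mulCayley (affGens ℓ)).Adj (affGroupEquiv hℓ (k, P)) (affGroupEquiv hℓ (m, Q)) ↔
      ∃ o o' : Option ι, o ≠ o' ∧ m = k + (placeExp o - placeExp o') ∧ ∃ b, Q - P =
        monomialUnit ℓ k * (constCoeff ℓ b * (monomialUnit ℓ (-placeExp o'))) := by
  set g := affGroupEquiv hℓ (k, P)
  set h := affGroupEquiv hℓ (m, Q)
  have h1 : (SimpleGraph.mulCayley (affGens ℓ)).Adj g h ↔ ∃ s ∈ genMatrices ℓ,
      (g : GL (Fin 2) (LaurentRing ℓ)) * s = h := by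
    rw [SimpleGraph.mulCayley_adj']
    constructor
    · rintro ⟨-, s, hs, hgs | hgs⟩
      · exact ⟨s, hs, by rw [← hgs]; rfl⟩
      · exact ⟨(s : GL (Fin 2) (LaurentRing ℓ))⁻¹, inv_mem_genMatrices hs, by rw [hgs]; simp⟩
    · rintro ⟨s, hs, hgs⟩
      refine ⟨?_, ⟨s, genMatrices_subset ℓ hs⟩, hs, Or.inl (Subtype.ext hgs)⟩
      rintro heq
      rw [heq, mul_eq_left] at hgs
      exact one_notMem_genMatrices hℓ (hgs ▸ hs)
  have h2 : ∀ (r : ι → ℤ) (R : LaurentRing ℓ),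
      (g : GL (Fin 2) (LaurentRing ℓ)) * affMat (monomialUnit ℓ r) R = h ↔
      m = k + r ∧ Q - P = monomialUnit ℓ k * R := by
    intro r R
    change affMat (monomialUnit ℓ k) P * _ = affMat (monomialUnit ℓ m) Q ↔ _
    rw [affMat_mul, ← monomialUnit_add, sub_eq_iff_eq_add]
    constructor
    · intro h
      obtain ⟨h3, h4⟩ := affMat_injective h
      exact ⟨(monomialUnit_injective hℓ h3).symm, h4.symm⟩
    · rintro ⟨rfl, rfl⟩
      rfl
  rw [h1]
  constructor
  · rintro ⟨s, hs, hgs⟩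
    obtain ⟨o, o', b, hne, rfl⟩ := mem_genMatrices_iff.1 hs
    rw [h2] at hgs
    exact ⟨o, o', hne, hgs.1, b, hgs.2⟩
  · rintro ⟨o, o', hne, h3, b, h4⟩
    exact ⟨_, mem_genMatrices_iff.2 ⟨o, o', b, hne, rfl⟩, (h2 _ _).2 ⟨h3, h4⟩⟩

theorem isCayleyGraphOf_affGens [Nonempty ι] [Nontrivial L] [Finite L] {q : ℕ}
    (hL : Nat.card L = q) (hℓ : ∀ i j, i ≠ j → IsUnit (ℓ i - ℓ j)) {κ : Type} [Fintype κ]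
    (e : κ ≃ Option ι) (T : κ → HorocyclicTree.{u} q) :
    IsCayleyGraphOf (DiestelLeader T) (affGens ℓ) := by
  classical
  choose Θ hhor hpred heq hsurj using fun i => exists_laurentRing_coordinates hℓ hL (T i) (e i)
  have hsum : ∀ k : ι → ℤ, ∑ i, placeVal k (e i) = 0 := fun k => by
    rw [Equiv.sum_comp e, sum_placeVal]
  have heq' : ∀ i n m P Q, Θ i n P = Θ i m Q ↔ n = m ∧ P - Q ∈ vanishing hℓ (e i) n := by
    intro i n m P Q
    constructor
    · intro h
      have h1 := congrArg (T i).hor h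
      rw [hhor, hhor] at h1
      subst h1
      exact ⟨rfl, (heq _ _ _ _).1 h⟩
    · rintro ⟨rfl, h⟩
      exact (heq _ _ _ _).2 h
  have hadj : ∀ i n m P Q, (T i).graph.Adj (Θ i n P) (Θ i m Q) ↔
      (m = n - 1 ∧ Q - P ∈ vanishing hℓ (e i) (n - 1)) ∨
        (m = n + 1 ∧ Q - P ∈ vanishing hℓ (e i) n) := by
    intro i n m P Q
    rw [HorocyclicTree.adj_iff, hpred, hpred, eq_comm, heq', heq']
    refine or_congr ⟨?_, ?_⟩ ⟨?_, ?_⟩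
    · rintro ⟨rfl, h⟩; exact ⟨rfl, h⟩
    · rintro ⟨rfl, h⟩; exact ⟨rfl, h⟩
    · rintro ⟨rfl, h⟩; exact ⟨by ring, h⟩
    · rintro ⟨rfl, h⟩; simpa using h
  -- The isomorphism: balls around one `P`, with the valuations prescribed by `k` as levels.
  let F : (ι → ℤ) × LaurentRing ℓ → {x : (i : κ) → (T i).V // ∑ i, (T i).hor (x i) = 0} :=
    fun p => ⟨fun i => Θ i (placeVal p.1 (e i)) p.2, by simp only [hhor, hsum]⟩
  have hF : Function.Bijective F := by
    constructor
    · rintro ⟨k, P⟩ ⟨m, Q⟩ h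
      have h1 : ∀ i, Θ i (placeVal k (e i)) P = Θ i (placeVal m (e i)) Q := fun i =>
        congrFun (congrArg Subtype.val h) i
      simp only [heq'] at h1
      have hkm : k = m := placeVal_injective (funext fun o => by
        simpa using (h1 (e.symm o)).1)
      subst hkm
      refine Prod.ext rfl (sub_eq_zero.1 ?_)
      have h2 : ((monomialUnit ℓ (-k) : (LaurentRing ℓ)ˣ) : LaurentRing ℓ) * (P - Q) = 0 := by
        refine eq_zero_of_forall_mem_vanishing hℓ fun o => ?_
        have h3 := (monomialUnit_mul_mem_vanishing hℓ (k := -k)).2 (h1 (e.symm o)).2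
        rwa [e.apply_symm_apply, placeVal_neg, add_neg_cancel] at h3
      exact (Units.mul_right_eq_zero _).1 h2
    · rintro ⟨x, hx⟩
      choose p hp using fun i => hsurj i (x i)
      obtain ⟨k, hk⟩ := exists_placeVal_eq (n := fun o => (T (e.symm o)).hor (x (e.symm o))) (by
        rw [← hx]
        exact Equiv.sum_comp e.symm fun i => (T i).hor (x i))
      have hk' : ∀ i, placeVal k (e i) = (T i).hor (x i) := fun i => by
        rw [hk]
        change (fun j => (T j).hor (x j)) (e.symm (e i)) = _
        rw [e.symm_apply_apply]
      obtain ⟨P, hP⟩ := exists_forall_sub_mem_vanishing hℓ k fun o => p (e.symm o)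
      refine ⟨(k, P), Subtype.ext (funext fun i => ?_)⟩
      change Θ i (placeVal k (e i)) P = x i
      rw [hk']
      refine ((heq i _ _ _).2 ?_).trans (hp i)
      rw [← hk']
      simpa using hP (e i)
  have hFadj : ∀ (k m : ι → ℤ) (P Q : LaurentRing ℓ), (DiestelLeader T).Adj (F (k, P)) (F (m, Q)) ↔
      ∃ o o' : Option ι, o ≠ o' ∧ m = k + (placeExp o - placeExp o') ∧ ∃ b, Q - P =
        monomialUnit ℓ k * (constCoeff ℓ b * (monomialUnit ℓ (-placeExp o'))) := by
    intro k m P Q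
    constructor
    · have key : ∀ i j, i ≠ j → placeVal m (e i) = placeVal k (e i) + 1 →
          Q - P ∈ vanishing hℓ (e i) (placeVal k (e i)) →
          placeVal m (e j) = placeVal k (e j) - 1 →
          Q - P ∈ vanishing hℓ (e j) (placeVal k (e j) - 1) →
          (∀ r, r ≠ i → r ≠ j → placeVal m (e r) = placeVal k (e r) ∧
            Q - P ∈ vanishing hℓ (e r) (placeVal k (e r))) →
          ∃ o o' : Option ι, o ≠ o' ∧ m = k + (placeExp o - placeExp o') ∧ ∃ b, Q - P =
            monomialUnit ℓ k * (constCoeff ℓ b * (monomialUnit ℓ (-placeExp o'))) := by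
        intro i j hij hi hi' hj hj' hr
        refine ⟨e i, e j, e.injective.ne hij, placeVal_injective (funext fun o => ?_),
          (forall_mem_vanishing_iff hℓ).1 ⟨fun o ho => ?_, hj'⟩⟩
        · obtain ⟨r, rfl⟩ := e.surjective o
          rw [sub_eq_add_neg, placeVal_add, placeVal_add, placeVal_neg, placeVal_placeExp,
            placeVal_placeExp]
          simp only [e.injective.eq_iff]
          rcases eq_or_ne r i with rfl | hri
          · rw [hi, if_pos rfl, if_neg hij]
            ring
          rcases eq_or_ne r j with rfl | hrj
          · rw [hj, if_pos rfl, if_neg hri]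
            ring
          rw [(hr r hri hrj).1, if_neg hri, if_neg hrj]
          ring
        · obtain ⟨r, rfl⟩ := e.surjective o
          rcases eq_or_ne r i with rfl | hri
          · exact hi'
          · exact (hr r hri fun h => ho (congrArg e h)).2
      rintro ⟨i, j, hij, hi, hj, hr⟩
      replace hi := (hadj _ _ _ _ _).1 hi
      replace hj := (hadj _ _ _ _ _).1 hj
      replace hr : ∀ r, r ≠ i → r ≠ j → placeVal m (e r) = placeVal k (e r) ∧
          Q - P ∈ vanishing hℓ (e r) (placeVal k (e r)) := fun r hri hrj => by
        obtain ⟨h1, h2⟩ := (heq' _ _ _ _ _).1 (hr r hri hrj)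
        exact ⟨h1.symm, by simpa using AddSubgroup.neg_mem _ h2⟩
      -- The total height is constant, so of the two coordinates that move one goes to a successor
      -- and the other to its predecessor.
      have h0 : ∑ r, (placeVal m (e r) - placeVal k (e r)) = 0 := by
        rw [Finset.sum_sub_distrib, hsum, hsum, sub_zero]
      rw [Fintype.sum_eq_add i j hij fun r h => by rw [(hr r h.1 h.2).1, sub_self]] at h0
      rcases hi with ⟨hi, hi'⟩ | ⟨hi, hi'⟩ <;> rcases hj with ⟨hj, hj'⟩ | ⟨hj, hj'⟩
      · dsimp only at hi hj
        omega
      · exact key j i hij.symm hj hj' hi hi' fun r h1 h2 => hr r h2 h1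
      · exact key i j hij hi hi' hj hj' hr
      · dsimp only at hi hj
        omega
    · rintro ⟨o, o', hne, rfl, hb⟩
      obtain ⟨i, rfl⟩ := e.surjective o
      obtain ⟨j, rfl⟩ := e.surjective o'
      have hij : i ≠ j := fun h => hne (congrArg e h)
      obtain ⟨h1, h2⟩ := (forall_mem_vanishing_iff hℓ).2 hb
      have hval : ∀ r, placeVal (k + (placeExp (e i) - placeExp (e j))) (e r) =
          placeVal k (e r) + ((if r = i then 1 else 0) - if r = j then 1 else 0) := fun r => by
        rw [sub_eq_add_neg, placeVal_add, placeVal_add, placeVal_neg, placeVal_placeExp,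
          placeVal_placeExp]
        simp only [e.injective.eq_iff]
        ring
      refine ⟨i, j, hij, (hadj _ _ _ _ _).2 (Or.inr ⟨?_, h1 _ hne⟩),
        (hadj _ _ _ _ _).2 (Or.inl ⟨?_, h2⟩), fun r hri hrj => (heq' _ _ _ _ _).2 ⟨?_, ?_⟩⟩
      · rw [hval, if_pos rfl, if_neg hij]
        ring
      · rw [hval, if_pos rfl, if_neg hij.symm]
        ring
      · rw [hval, if_neg hri, if_neg hrj]
        ring
      · simpa using AddSubgroup.neg_mem _ (h1 _ (e.injective.ne hrj))
  refine ⟨fun s hs => inv_mem_genMatrices hs, one_notMem_genMatrices hℓ, closure_affGens,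
    ⟨⟨(affGroupEquiv hℓ).symm.trans (Equiv.ofBijective F hF), ?_⟩⟩⟩
  intro a b
  obtain ⟨⟨k, P⟩, rfl⟩ := (affGroupEquiv hℓ).surjective a
  obtain ⟨⟨m, Q⟩, rfl⟩ := (affGroupEquiv hℓ).surjective b
  simp only [Equiv.trans_apply, Equiv.symm_apply_apply, Equiv.ofBijective_apply, hFadj,
    mulCayley_affGens_adj]

end Isomorphism

end

/-! ### Specializations: `d` trees, products of finite fields, and three trees over `ℤ/qℤ` -/

theorem isCayleyGraphOf_affGens_fin {d q : ℕ} (hd : 2 ≤ d) (hq : 2 ≤ q) {L : Type v} [CommRing L]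
    [Finite L] (hL : Nat.card L = q) {ℓ : Fin (d - 1) → L}
    (hℓ : ∀ i j, i ≠ j → IsUnit (ℓ i - ℓ j)) (T : Fin d → HorocyclicTree.{u} q) :
    IsCayleyGraphOf (DiestelLeader T) (affGens ℓ) := by
  have : Nonempty (Fin (d - 1)) := ⟨⟨0, by omega⟩⟩
  have : Nontrivial L := Finite.one_lt_card_iff_nontrivial.1 (by omega)
  exact isCayleyGraphOf_affGens hL hℓ
    (Fintype.equivOfCardEq (by rw [Fintype.card_option, Fintype.card_fin, Fintype.card_fin]; omega)) T

theorem card_fieldProduct {q : ℕ} (hq : q ≠ 0) : Nat.card (FieldProduct q) = q := by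
  rw [Nat.card_pi]
  calc ∏ p : q.primeFactors, Nat.card (GaloisField (p : ℕ) (q.factorization (p : ℕ)))
      = ∏ p : q.primeFactors, (p : ℕ) ^ q.factorization (p : ℕ) :=
        Finset.prod_congr rfl fun p _ => GaloisField.card _ _
          (Finsupp.mem_support_iff.1 (by rw [Nat.support_factorization]; exact p.2))
    _ = q := by
      rw [Finset.prod_coe_sort q.primeFactors fun p => p ^ q.factorization p]
      exact Nat.prod_factorization_pow_eq_self hq

theorem exists_injective_galoisField {p n : ℕ} [Fact p.Prime] (hn : n ≠ 0) {d : ℕ} (hd : d ≤ p ^ n) :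
    ∃ f : Fin d → GaloisField p n, Function.Injective f := by
  have hc : Nat.card (GaloisField p n) = p ^ n := GaloisField.card p n hn
  have e := (Finite.equivFin (GaloisField p n)).symm
  rw [hc] at e
  exact ⟨e ∘ Fin.castLE hd, e.injective.comp (Fin.castLE_injective hd)⟩

theorem isUnit_sub_of_injective_apply {κ : Type} {F : κ → Type v} [∀ p, Field (F p)] {ι : Type}
    {ℓ : ι → (p : κ) → F p} (h : ∀ p, Function.Injective fun j => ℓ j p) {i j : ι} (hij : i ≠ j) :
    IsUnit (ℓ i - ℓ j) := by
  rw [Pi.isUnit_iff]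
  exact fun p => (sub_ne_zero.2 fun h' => hij (h p h')).isUnit

theorem units_ext_affMat {R : Type v} [CommRing R] {g : GL (Fin 2) R} {a : Rˣ} {A P : R}
    (hA : A = a) : (g : Matrix (Fin 2) (Fin 2) R) = !![A, P; 0, 1] ↔ g = affMat a P := by
  subst hA
  exact (Units.ext_iff (u := g) (v := affMat a P)).symm

theorem mem_genMatricesThree_iff {q : ℕ} {g : GL (Fin 2) (LaurentRing (zeroOne q))} :
    g ∈ genMatricesThree q ↔ ∃ b : ZMod q,
      g = affMat (tAdd (zeroOne q) 0) (constCoeff _ b) ∨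
      g = affMat (tAdd (zeroOne q) 1) (constCoeff _ b) ∨
      g = affMat (tAdd (zeroOne q) 1 * (tAdd (zeroOne q) 0)⁻¹)
        (-(constCoeff _ b * (((tAdd (zeroOne q) 0)⁻¹ : (LaurentRing (zeroOne q))ˣ) :
          LaurentRing (zeroOne q)))) := by
  have h0 : algebraMap (ZMod q)[X] (LaurentRing (zeroOne q)) Polynomial.X =
      tAdd (zeroOne q) 0 := by
    rw [tAdd_val]; simp
  have h1 : algebraMap (ZMod q)[X] (LaurentRing (zeroOne q)) Polynomial.X + 1 =
      tAdd (zeroOne q) 1 := by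
    rw [tAdd_val]; simp
  have h2 : (((tAdd (zeroOne q) 0)⁻¹ : (LaurentRing (zeroOne q))ˣ) : LaurentRing (zeroOne q)) + 1 =
      (tAdd (zeroOne q) 1 * (tAdd (zeroOne q) 0)⁻¹ : (LaurentRing (zeroOne q))ˣ) := by
    rw [Units.val_mul, ← h1, h0, add_mul, one_mul, Units.mul_inv, add_comm]
  exact exists_congr fun b => or_congr (units_ext_affMat h0)
    (or_congr (units_ext_affMat h1) (units_ext_affMat h2))

theorem affGensThree_eq (q : ℕ) : affGensThree q = affGens (zeroOne q) := by
  have hsub : genMatricesThree q ⊆ genMatrices (zeroOne q) := by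
    intro g hg
    obtain ⟨b, rfl | rfl | rfl⟩ := mem_genMatricesThree_iff.1 hg
    · exact Or.inl ⟨0, b, Or.inl rfl⟩
    · exact Or.inl ⟨1, b, Or.inl rfl⟩
    · exact Or.inr ⟨1, 0, b, by decide, rfl⟩
  ext g
  constructor
  · rintro (h | h)
    · exact hsub h
    · have := inv_mem_genMatrices (hsub h)
      rwa [inv_inv] at this
  · have hfin : ∀ i : Fin 2, i = 0 ∨ i = 1 := by decide
    intro hg
    change (g : GL (Fin 2) (LaurentRing (zeroOne q))) ∈ genMatricesThree q ∨ _ ∈ genMatricesThree q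
    change (g : GL (Fin 2) (LaurentRing (zeroOne q))) ∈ genMatrices (zeroOne q) at hg
    generalize (g : GL (Fin 2) (LaurentRing (zeroOne q))) = g at hg
    simp only [mem_genMatricesThree_iff]
    rcases hg with ⟨i, b, rfl | rfl⟩ | ⟨i, j, b, hij, rfl⟩
    · rcases hfin i with rfl | rfl
      · exact Or.inl ⟨b, Or.inl rfl⟩
      · exact Or.inl ⟨b, Or.inr (Or.inl rfl)⟩
    · rw [inv_inv]
      rcases hfin i with rfl | rfl
      · exact Or.inr ⟨b, Or.inl rfl⟩
      · exact Or.inr ⟨b, Or.inr (Or.inl rfl)⟩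
    · rcases hfin i with rfl | rfl <;> rcases hfin j with rfl | rfl
      · exact (hij rfl).elim
      -- The pair `(0, 1)` is missing from the list of three families; its matrices are the inverses
      -- of those for `(1, 0)`, with `b` negated.
      · refine Or.inr ⟨-b, Or.inr (Or.inr ?_)⟩
        rw [affMat_inv, mul_inv, inv_inv, mul_comm (tAdd (zeroOne q) 0)⁻¹]
        congr 1
        have hneg : constCoeff (zeroOne q) (-b) = -constCoeff (zeroOne q) b := by simp [constCoeff]
        rw [hneg, Units.val_mul, neg_mul_neg, neg_mul, neg_neg, mul_assoc, mul_left_comm,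
          mul_left_comm, mul_comm (constCoeff _ b), ← mul_assoc, mul_right_comm,
          Units.mul_inv_cancel_left]
      · exact Or.inl ⟨b, Or.inr (Or.inr rfl)⟩
      · exact (hij rfl).elim

theorem theorem3p1 :
    -- the general result
    (∀ (d q : ℕ), 2 ≤ d → 2 ≤ q →
      ∀ (L : Type v) [CommRing L] [Finite L], Nat.card L = q →
      ∀ ℓ : Fin (d - 1) → L, (∀ i j, i ≠ j → IsUnit (ℓ i - ℓ j)) →
      ∀ T : Fin d → HorocyclicTree.{u} q,
        IsCayleyGraphOf (DiestelLeader T) (affGens ℓ)) ∧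
    -- all prime powers in the factorization of `q` are at least `d - 1`
    (∀ (d q : ℕ), 2 ≤ d → 2 ≤ q →
      (∀ p ∈ q.primeFactors, d - 1 ≤ p ^ q.factorization p) →
      Nat.card (FieldProduct q) = q ∧
      (∃ ℓ : Fin (d - 1) → FieldProduct q, ∀ p, Function.Injective fun j => ℓ j p) ∧
      ∀ ℓ : Fin (d - 1) → FieldProduct q, (∀ p, Function.Injective fun j => ℓ j p) →
        (∀ i j, i ≠ j → IsUnit (ℓ i - ℓ j)) ∧
        ∀ T : Fin d → HorocyclicTree.{u} q,
          IsCayleyGraphOf (DiestelLeader T) (affGens ℓ)) ∧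
    -- three trees, with coefficients in `ℤ/qℤ`
    (∀ q : ℕ, 2 ≤ q → ∀ T : Fin 3 → HorocyclicTree.{u} q,
      IsCayleyGraphOf (DiestelLeader T) (affGensThree q)) := by

  refine ⟨fun d q hd hq L _ _ hL ℓ hℓ T => isCayleyGraphOf_affGens_fin hd hq hL hℓ T,
    fun d q hd hq hp => ?_, fun q hq T => ?_⟩
  · have hcard : Nat.card (FieldProduct q) = q := card_fieldProduct (by omega)
    have hne : ∀ p : q.primeFactors, q.factorization (p : ℕ) ≠ 0 := fun p =>
      Finsupp.mem_support_iff.1 (by rw [Nat.support_factorization]; exact p.2)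
    have : Finite (FieldProduct q) := Nat.finite_of_card_ne_zero (by omega)
    refine ⟨hcard, ?_, fun ℓ hℓ => ?_⟩
    · choose f hf using fun p : q.primeFactors => exists_injective_galoisField (hne p) (hp p p.2)
      exact ⟨fun j p => f p j, hf⟩
    · have hunit : ∀ i j, i ≠ j → IsUnit (ℓ i - ℓ j) := fun i j hij =>
        isUnit_sub_of_injective_apply hℓ hij
      exact ⟨hunit, fun T => isCayleyGraphOf_affGens_fin hd hq hcard hunit T⟩
  · have : NeZero q := ⟨by omega⟩
    rw [affGensThree_eq]
    refine isCayleyGraphOf_affGens_fin (d := 3) (by norm_num) hq (Nat.card_zmod q) ?_ T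
    -- The only differences are `±1`, units for every `q`.
    have h1 : IsUnit (zeroOne q 0 - zeroOne q 1) := by simp
    have h2 : IsUnit (zeroOne q 1 - zeroOne q 0) := by simp
    intro i j hij
    have hfin : ∀ i : Fin 2, i = 0 ∨ i = 1 := by decide
    rcases hfin i with rfl | rfl <;> rcases hfin j with rfl | rfl
    · exact (hij rfl).elim
    · exact h1
    · exact h2
    · exact (hij rfl).elim
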